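/- Let ${\mathcal H}=\{h_\nu\}_{\nu=1}^\infty$ be a family of convex functions $h_\nu:\mathbb R^n\to\mathbb R$ such that for each $\nu\in\mathbb N$: 1) $h_\nu(x)=h_\nu(|x_1|,\ldots,|x_n|)$ for $x\in\mathbb R^n$; 2) the restriction of $h_\nu$ to $[0,\infty)^n$ is nondecreasing in each variable; 3) $h_\nu(x)/\|x\|\to+\infty$ as $x\to\infty$, where $\|\cdot\|$ is the Euclidean norm; 4) for each $M>0$ there is a constant $A_{\nu,M}>0$ with $h_\nu(x)\le\sum_{1\le j\le n:\,x_j\ne0}x_j\ln\frac{x_j}{M}+A_{\nu,M}$ for $x\in[0,\infty)^n$; 5) there is a constant $\gamma_\nu$ with $h_\nu(x)-h_{\nu+1}(x)\ge\ln 2\cdot\sum_{j=1}^n x_j-\gamma_\nu$ for $x\in[0,\infty)^n$; 6) there is a constant $l_\nu$ with $h_{\nu+1}(x+y)\le h_\nu(x)+h_\nu(y)+l_\nu$ for $x,y\in[0,\infty)^n$. Let $G(h_\nu)$ be the space of all $f:\mathbb R^n\to\mathbb C$ such that for every $m\in\mathbb Z_+$ one has $f\in C^m(\mathbb R^n)$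 and $$\|f\|_{m,h_\nu}=\sup_{x\in\mathbb R^n,\ \beta\in\mathbb Z_+^n,\ |\alpha|\le m}\frac{|x^\beta (D^\alpha f)(x)|}{\beta!\,e^{-h_\nu(\beta)}}<\infty ,$$ with the topology defined by the norms $\|\cdot\|_{m,h_\nu}$, $m\in\mathbb Z_+$, and let $G({\mathcal H})=\bigcup_\nu G(h_\nu)$ carry the (locally convex) inductive limit topology. Let $\varphi_\nu(x)=h_\nu^*(\ln(1+|x_1|),\ldots,\ln(1+|x_n|))$, where $h_\nu^*(x)=\sup_{y\in\mathbb R^n}(\langle x,y\rangle-h_\nu(y))$. Let $E(\varphi_\nu)$ be the space of all entire functions $F$ on $\mathbb C^n$ such that for every $m\in\mathbb Z_+$ $$p_{\nu,m}(F)=\sup_{z\in\mathbb C^n}\frac{|F(z)|(1+\|z\|)^m}{e^{\varphi_\nu(\operatorname{Im}z)}}<\infty ,$$ with the topology defined by the norms $p_{\nu,m}$, $m\in\mathbb Z_+$, and let $E(\varPhi)=\bigcup_\nu E(\varphi_\nu)$ carry the (locally convex) inductive limit topology. For $f\in G({\mathcal H})$ let $({\mathcal F}f)(x)=(2\pi)^{-n/2}\int_{\mathbb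 R^n}f(\xi)e^{i\langle x,\xi\rangle}\,d\xi$, $x\in\mathbb R^n$. Let ${\mathcal E}({\mathcal H})$ be the set of all $f\in C^\infty(\mathbb R^n)$ for which there is a $\nu$ such that for every $m\in\mathbb Z_+$ $$\sup_{x\in\mathbb R^n,\ \alpha\in\mathbb Z_+^n}\frac{(1+\|x\|)^m|(D^\alpha f)(x)|}{\alpha!\,e^{-h_\nu(\alpha)}}<\infty ,$$ and for $f\in{\mathcal E}({\mathcal H})$ let ${\mathcal A}f$ be the extension of $f$ to $\mathbb C^n$ given by its Taylor series, $({\mathcal A}f)(z)=\sum_{\alpha\in\mathbb Z_+^n}\frac{(D^\alpha f)(0)}{\alpha!}z^\alpha$. Theorem. For every $f\in G({\mathcal H})$ the integral defining ${\mathcal F}f$ converges absolutely, ${\mathcal F}f\in{\mathcal E}({\mathcal H})$, and the Taylor series of ${\mathcal F}f$ at $0$ converges absolutely at every point of $\mathbb C^n$ to a function that extends ${\mathcal F}f$. The composition ${\mathcal A}{\mathcal F}$ is an isomorphism of topological vector spaces (a linear homeomorphism) from $G({\mathcal H})$ onto $E(\varPhi)$. -/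

import Mathlib

open MeasureTheory Filter

noncomputable section

namespace PaleyWiener

/-- `ℝⁿ` with its Euclidean norm. -/
abbrev RSp (n : ℕ) : Type := EuclideanSpace ℝ (Fin n)

/-- `ℂⁿ` with its Euclidean norm. -/
abbrev CSp (n : ℕ) : Type := EuclideanSpace ℂ (Fin n)

variable {n : ℕ}

/-! ### The weights -/

/-- A family `h₀, h₁, h₂, …` of convex functions on `ℝⁿ` with the six standing properties.
(The sequence is indexed from `0` instead of `1`.) -/
structure WeightFamily (n : ℕ) where
  /-- the weight functions -/
  h : ℕ → (Fin n → ℝ) → ℝ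
  convex : ∀ ν, ConvexOn ℝ Set.univ (h ν)
  even : ∀ ν x, h ν x = h ν (fun j => |x j|)
  mono : ∀ ν, MonotoneOn (h ν) {x | ∀ j, 0 ≤ x j}
  superlinear : ∀ ν, Tendsto (fun x : Fin n → ℝ => h ν x / ‖(WithLp.toLp 2 x : RSp n)‖)
    (cocompact (Fin n → ℝ)) atTop
  /- the terms with `x j = 0` vanish, since `0 * log 0 = 0` -/
  upper : ∀ ν, ∀ M : ℝ, 0 < M → ∃ A : ℝ, 0 < A ∧ ∀ x : Fin n → ℝ, (∀ j, 0 ≤ x j) →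
    h ν x ≤ ∑ j, x j * Real.log (x j / M) + A
  gap : ∀ ν, ∃ γ : ℝ, ∀ x : Fin n → ℝ, (∀ j, 0 ≤ x j) →
    Real.log 2 * ∑ j, x j - γ ≤ h ν x - h (ν + 1) x
  subadd : ∀ ν, ∃ l : ℝ, ∀ x y : Fin n → ℝ, (∀ j, 0 ≤ x j) → (∀ j, 0 ≤ y j) →
    h (ν + 1) (x + y) ≤ h ν x + h ν y + l

/-- The Young-Fenchel conjugate `g^*(x) = sup_y (⟨x, y⟩ - g y)`.  For the weights considered here
the supremum is finite, see `bddAbove_conj`. -/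
def conj (g : (Fin n → ℝ) → ℝ) (x : Fin n → ℝ) : ℝ :=
  ⨆ y : Fin n → ℝ, (∑ j, x j * y j - g y)

/-- `φ_ν(x) = h_ν^*(ln (1 + |x₁|), …, ln (1 + |xₙ|))`. -/
def phi (H : WeightFamily n) (ν : ℕ) (x : Fin n → ℝ) : ℝ :=
  conj (H.h ν) (fun j => Real.log (1 + |x j|))

/-! ### Multi-indices and derivatives -/

/-- The partial derivative `∂f/∂x_j`. -/
def partialDeriv (j : Fin n) (f : RSp n → ℂ) : RSp n → ℂ :=
  fun x => fderiv ℝ f x (EuclideanSpace.single j (1 : ℝ))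

/-- `D^α f = ∂^{α₁}/∂x₁^{α₁} ⋯ ∂^{αₙ}/∂xₙ^{αₙ} f`. -/
def multiDeriv (α : Fin n → ℕ) (f : RSp n → ℂ) : RSp n → ℂ :=
  (List.finRange n).foldr (fun j g => (partialDeriv j)^[α j] g) f

/-- `β! = β₁! ⋯ βₙ!`. -/
def multiFactorial (β : Fin n → ℕ) : ℝ := ∏ j, ((β j).factorial : ℝ)

/-- `g(β)` for a multi-index `β`. -/
def atIndex (g : (Fin n → ℝ) → ℝ) (β : Fin n → ℕ) : ℝ := g (fun j => (β j : ℝ))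

/-- `β! e^{-g(β)}`. -/
def indexWeight (g : (Fin n → ℝ) → ℝ) (β : Fin n → ℕ) : ℝ :=
  multiFactorial β * Real.exp (-atIndex g β)

/-! ### The spaces `G(h_ν)` -/

/-- The index set `{(x, β, α) : x ∈ ℝⁿ, |α| ≤ m}` of the supremum defining `‖·‖_{m,g}`. -/
abbrev GIndex (n m : ℕ) : Type :=
  RSp n × (Fin n → ℕ) × {α : Fin n → ℕ // ∑ j, α j ≤ m}

/-- `|x^β (D^α f)(x)| / (β! e^{-g(β)})`. -/
def gTerm (g : (Fin n → ℝ) → ℝ) (m : ℕ) (f : RSp n → ℂ) (i : GIndex n m) : ℝ :=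
  |∏ j, (i.1 j) ^ (i.2.1 j)| * ‖multiDeriv i.2.2.1 f i.1‖ / indexWeight g i.2.1

/-- `‖f‖_{m,g}`, the supremum of `|x^β (D^α f)(x)| / (β! e^{-g(β)})` over `x`, `β`, `|α| ≤ m`. -/
def gNorm (g : (Fin n → ℝ) → ℝ) (m : ℕ) (f : RSp n → ℂ) : ℝ := ⨆ i, gTerm g m f i

/-! ### The spaces `E(φ_ν)` -/

/-- `|F(z)| (1 + ‖z‖)^m / e^{φ(Im z)}`. -/
def eTerm (φ : (Fin n → ℝ) → ℝ) (m : ℕ) (F : CSp n → ℂ) (z : CSp n) : ℝ :=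
  ‖F z‖ * (1 + ‖z‖) ^ m / Real.exp (φ (fun j => (z j).im))

/-- `p_m(F)`, the supremum of `|F(z)| (1 + ‖z‖)^m / e^{φ(Im z)}` over `z ∈ ℂⁿ`. -/
def eNorm (φ : (Fin n → ℝ) → ℝ) (m : ℕ) (F : CSp n → ℂ) : ℝ := ⨆ z, eTerm φ m F z

/-! ### Elementary facts needed to form the spaces -/

theorem contDiff_partialDeriv (j : Fin n) {k : ℕ} {f : RSp n → ℂ}
    (hf : ContDiff ℝ ((k + 1 : ℕ) : WithTop ℕ∞) f) :
    ContDiff ℝ (k : WithTop ℕ∞) (partialDeriv j f) := by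
  unfold partialDeriv
  exact (hf.fderiv_right (m := (k : WithTop ℕ∞)) (by norm_cast)).clm_apply contDiff_const

theorem partialDeriv_lin (j : Fin n) (c : ℂ) {f g : RSp n → ℂ}
    (hf : Differentiable ℝ f) (hg : Differentiable ℝ g) :
    partialDeriv j (c • f + g) = c • partialDeriv j f + partialDeriv j g := by
  funext x
  simp only [partialDeriv]
  rw [fderiv_add ((hf x).const_smul c) (hg x), fderiv_const_smul (hf x)]
  rfl

theorem iterate_partialDeriv (j : Fin n) (a k : ℕ) (c : ℂ) {f g : RSp n → ℂ}
    (hf : ContDiff ℝ ((a + k : ℕ) : WithTop ℕ∞) f)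
    (hg : ContDiff ℝ ((a + k : ℕ) : WithTop ℕ∞) g) :
    ContDiff ℝ (k : WithTop ℕ∞) ((partialDeriv j)^[a] f) ∧
    ContDiff ℝ (k : WithTop ℕ∞) ((partialDeriv j)^[a] g) ∧
    (partialDeriv j)^[a] (c • f + g) = c • (partialDeriv j)^[a] f + (partialDeriv j)^[a] g := by
  induction a generalizing f g with
  | zero =>
    rw [Nat.zero_add] at hf hg
    exact ⟨hf, hg, rfl⟩
  | succ a ih =>
    have e : a + 1 + k = (a + k) + 1 := by omega
    rw [e] at hf hg
    have h1 : ((a + k + 1 : ℕ) : WithTop ℕ∞) ≠ 0 := by norm_cast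
    simp only [Function.iterate_succ_apply]
    rw [partialDeriv_lin j c (hf.differentiable h1) (hg.differentiable h1)]
    exact ih (contDiff_partialDeriv j hf) (contDiff_partialDeriv j hg)

theorem foldr_partialDeriv (α : Fin n → ℕ) (c : ℂ) {f g : RSp n → ℂ} (L : List (Fin n)) (k : ℕ)
    (hf : ContDiff ℝ (((L.map α).sum + k : ℕ) : WithTop ℕ∞) f)
    (hg : ContDiff ℝ (((L.map α).sum + k : ℕ) : WithTop ℕ∞) g) :
    ContDiff ℝ (k : WithTop ℕ∞) (L.foldr (fun j g => (partialDeriv j)^[α j] g) f) ∧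
    ContDiff ℝ (k : WithTop ℕ∞) (L.foldr (fun j g => (partialDeriv j)^[α j] g) g) ∧
    L.foldr (fun j g => (partialDeriv j)^[α j] g) (c • f + g) =
      c • L.foldr (fun j g => (partialDeriv j)^[α j] g) f +
        L.foldr (fun j g => (partialDeriv j)^[α j] g) g := by
  induction L generalizing k with
  | nil =>
    rw [List.map_nil, List.sum_nil, Nat.zero_add] at hf hg
    exact ⟨hf, hg, rfl⟩
  | cons j L ih =>
    have e : ((j :: L).map α).sum + k = (L.map α).sum + (α j + k) := by
      simp only [List.map_cons, List.sum_cons]; omega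
    rw [e] at hf hg
    obtain ⟨h1, h2, h3⟩ := ih (α j + k) hf hg
    simp only [List.foldr_cons]
    rw [h3]
    exact iterate_partialDeriv j (α j) k c h1 h2

theorem multiDeriv_lin {α : Fin n → ℕ} {m : ℕ} (hα : ∑ j, α j ≤ m) (c : ℂ) {f g : RSp n → ℂ}
    (hf : ContDiff ℝ (m : WithTop ℕ∞) f) (hg : ContDiff ℝ (m : WithTop ℕ∞) g) :
    multiDeriv α (c • f + g) = c • multiDeriv α f + multiDeriv α g := by
  have e : ((List.finRange n).map α).sum + (m - ∑ j, α j) = m := by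
    rw [← List.ofFn_eq_map, List.sum_ofFn]; omega
  exact (foldr_partialDeriv α c (List.finRange n) (m - ∑ j, α j)
    (by rw [e]; exact hf) (by rw [e]; exact hg)).2.2

theorem multiDeriv_zero (α : Fin n → ℕ) : multiDeriv α (0 : RSp n → ℂ) = 0 := by
  have := multiDeriv_lin (le_refl (∑ j, α j)) (-1) (f := (0 : RSp n → ℂ)) (g := 0)
    contDiff_zero_fun contDiff_zero_fun
  simpa using this

theorem indexWeight_pos (g : (Fin n → ℝ) → ℝ) (β : Fin n → ℕ) : 0 < indexWeight g β :=
  mul_pos (Finset.prod_pos fun j _ => by exact_mod_cast (β j).factorial_pos) (Real.exp_pos _)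

theorem gTerm_nonneg (g : (Fin n → ℝ) → ℝ) (m : ℕ) (f : RSp n → ℂ) (i : GIndex n m) :
    0 ≤ gTerm g m f i :=
  div_nonneg (mul_nonneg (abs_nonneg _) (norm_nonneg _)) (indexWeight_pos g _).le

theorem gTerm_lin (g : (Fin n → ℝ) → ℝ) (m : ℕ) (c : ℂ) {f₁ f₂ : RSp n → ℂ}
    (h₁ : ContDiff ℝ (m : WithTop ℕ∞) f₁) (h₂ : ContDiff ℝ (m : WithTop ℕ∞) f₂)
    (i : GIndex n m) :
    gTerm g m (c • f₁ + f₂) i ≤ ‖c‖ * gTerm g m f₁ i + gTerm g m f₂ i := by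
  unfold gTerm
  rw [multiDeriv_lin i.2.2.2 c h₁ h₂, ← mul_div_assoc, ← add_div]
  refine div_le_div_of_nonneg_right ?_ (indexWeight_pos g _).le
  have : ‖(c • multiDeriv i.2.2.1 f₁ + multiDeriv i.2.2.1 f₂) i.1‖ ≤
      ‖c‖ * ‖multiDeriv i.2.2.1 f₁ i.1‖ + ‖multiDeriv i.2.2.1 f₂ i.1‖ := by
    refine (norm_add_le _ _).trans (le_of_eq ?_)
    simp
  calc _ ≤ _ := mul_le_mul_of_nonneg_left this (abs_nonneg _)
    _ = _ := by ring

theorem contDiff_zero_RSp (m : ℕ) : ContDiff ℝ (m : WithTop ℕ∞) (0 : RSp n → ℂ) :=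
  contDiff_zero_fun

theorem gTerm_zero (g : (Fin n → ℝ) → ℝ) (m : ℕ) (i : GIndex n m) : gTerm g m 0 i = 0 := by
  simp [gTerm, multiDeriv_zero]

theorem eTerm_nonneg (φ : (Fin n → ℝ) → ℝ) (m : ℕ) (F : CSp n → ℂ) (z : CSp n) :
    0 ≤ eTerm φ m F z := by
  unfold eTerm; positivity

theorem eTerm_lin (φ : (Fin n → ℝ) → ℝ) (m : ℕ) (c : ℂ) (F₁ F₂ : CSp n → ℂ) (z : CSp n) :
    eTerm φ m (c • F₁ + F₂) z ≤ ‖c‖ * eTerm φ m F₁ z + eTerm φ m F₂ z := by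
  unfold eTerm
  rw [← mul_div_assoc, ← add_div]
  refine div_le_div_of_nonneg_right ?_ (Real.exp_pos _).le
  have : ‖(c • F₁ + F₂) z‖ ≤ ‖c‖ * ‖F₁ z‖ + ‖F₂ z‖ := by
    refine (norm_add_le _ _).trans (le_of_eq ?_)
    simp
  calc _ ≤ _ := mul_le_mul_of_nonneg_right this (by positivity)
    _ = _ := by ring

theorem bddAbove_lin {ι : Type*} {u v w : ι → ℝ} {c : ℝ} (hc : 0 ≤ c)
    (h : ∀ i, w i ≤ c * u i + v i) (hu : BddAbove (Set.range u)) (hv : BddAbove (Set.range v)) :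
    BddAbove (Set.range w) := by
  obtain ⟨A, hA⟩ := hu
  obtain ⟨B, hB⟩ := hv
  refine ⟨c * A + B, ?_⟩
  rintro _ ⟨i, rfl⟩
  exact (h i).trans (add_le_add (mul_le_mul_of_nonneg_left (hA ⟨i, rfl⟩) hc) (hB ⟨i, rfl⟩))

/-! ### The step spaces with their topologies -/

/-- `G_m(g)`: the functions `f ∈ C^m(ℝⁿ)` with `‖f‖_{m,g} < ∞`. -/
def Gm (g : (Fin n → ℝ) → ℝ) (m : ℕ) : Submodule ℂ (RSp n → ℂ) where
  carrier := {f | ContDiff ℝ (m : WithTop ℕ∞) f ∧ BddAbove (Set.range (gTerm g m f))}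
  zero_mem' := ⟨contDiff_zero_fun, ⟨0, by rintro _ ⟨i, rfl⟩; rw [gTerm_zero]⟩⟩
  add_mem' := by
    rintro f₁ f₂ ⟨h₁, b₁⟩ ⟨h₂, b₂⟩
    exact ⟨h₁.add h₂, bddAbove_lin (norm_nonneg (1 : ℂ))
      (fun i => by simpa using gTerm_lin g m 1 h₁ h₂ i) b₁ b₂⟩
  smul_mem' := by
    rintro c f ⟨h, b⟩
    refine ⟨h.const_smul c, bddAbove_lin (norm_nonneg c)
      (v := gTerm g m 0)
      (fun i => by simpa using gTerm_lin g m c h (contDiff_zero_RSp m) i) b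
      ⟨0, ?_⟩⟩
    rintro _ ⟨i, rfl⟩
    exact (gTerm_zero g m i).le

/-- `G(g) = ⋂_m G_m(g)`. -/
def Gstep (g : (Fin n → ℝ) → ℝ) : Submodule ℂ (RSp n → ℂ) := ⨅ m, Gm g m

theorem Gstep_mem {g : (Fin n → ℝ) → ℝ} (f : Gstep g) (m : ℕ) : (f : RSp n → ℂ) ∈ Gm g m :=
  (Submodule.mem_iInf _).1 f.2 m

/-- `‖·‖_{m,g}` as a seminorm on `G(g)`. -/
def gSeminorm (g : (Fin n → ℝ) → ℝ) (m : ℕ) : Seminorm ℂ (Gstep g) :=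
  Seminorm.ofSMulLE (fun f => gNorm g m f)
    (by simp [gNorm, gTerm_zero])
    (fun f₁ f₂ => by
      have : Nonempty (GIndex n m) := ⟨(0, 0, ⟨0, by simp⟩)⟩
      refine ciSup_le fun i => ?_
      have := gTerm_lin g m 1 (Gstep_mem f₁ m).1 (Gstep_mem f₂ m).1 i
      simp only [one_smul, norm_one, one_mul] at this
      exact this.trans (add_le_add (le_ciSup (Gstep_mem f₁ m).2 i)
        (le_ciSup (Gstep_mem f₂ m).2 i)))
    (fun c f => by
      have : Nonempty (GIndex n m) := ⟨(0, 0, ⟨0, by simp⟩)⟩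
      refine ciSup_le fun i => ?_
      have := gTerm_lin g m c (Gstep_mem f m).1 (contDiff_zero_RSp m) i
      rw [gTerm_zero, add_zero, add_zero] at this
      exact this.trans (mul_le_mul_of_nonneg_left (le_ciSup (Gstep_mem f m).2 i) (norm_nonneg c)))

/-- The norms `‖·‖_{m,g}`, `m = 0, 1, 2, …`, on `G(g)`. -/
def gFamily (g : (Fin n → ℝ) → ℝ) : SeminormFamily ℂ (Gstep g) ℕ := fun m => gSeminorm g m

/-- The topology of `G(g)` defined by the norms `‖·‖_{m,g}`. -/
abbrev gTopology (g : (Fin n → ℝ) → ℝ) : TopologicalSpace (Gstep g) :=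
  (gFamily g).moduleFilterBasis.topology

/-- `E_m(φ)`: the entire functions `F` on `ℂⁿ` with `p_m(F) < ∞`. -/
def Em (φ : (Fin n → ℝ) → ℝ) (m : ℕ) : Submodule ℂ (CSp n → ℂ) where
  carrier := {F | Differentiable ℂ F ∧ BddAbove (Set.range (eTerm φ m F))}
  zero_mem' := ⟨differentiable_const 0, ⟨0, by rintro _ ⟨i, rfl⟩; simp [eTerm]⟩⟩
  add_mem' := by
    rintro f₁ f₂ ⟨h₁, b₁⟩ ⟨h₂, b₂⟩
    exact ⟨h₁.add h₂, bddAbove_lin (norm_nonneg (1 : ℂ))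
      (fun i => by simpa using eTerm_lin φ m 1 f₁ f₂ i) b₁ b₂⟩
  smul_mem' := by
    rintro c f ⟨h, b⟩
    refine ⟨h.const_smul c, bddAbove_lin (norm_nonneg c)
      (v := eTerm φ m 0)
      (fun i => by simpa using eTerm_lin φ m c f 0 i) b ⟨0, ?_⟩⟩
    rintro _ ⟨i, rfl⟩
    simp [eTerm]

/-- `E(φ) = ⋂_m E_m(φ)`. -/
def Estep (φ : (Fin n → ℝ) → ℝ) : Submodule ℂ (CSp n → ℂ) := ⨅ m, Em φ m

theorem Estep_mem {φ : (Fin n → ℝ) → ℝ} (F : Estep φ) (m : ℕ) : (F : CSp n → ℂ) ∈ Em φ m :=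
  (Submodule.mem_iInf _).1 F.2 m

/-- `p_m` as a seminorm on `E(φ)`. -/
def eSeminorm (φ : (Fin n → ℝ) → ℝ) (m : ℕ) : Seminorm ℂ (Estep φ) :=
  Seminorm.ofSMulLE (fun F => eNorm φ m F)
    (by simp [eNorm, eTerm])
    (fun f₁ f₂ => by
      refine ciSup_le fun i => ?_
      have := eTerm_lin φ m 1 f₁ f₂ i
      simp only [one_smul, norm_one, one_mul] at this
      exact this.trans (add_le_add (le_ciSup (Estep_mem f₁ m).2 i)
        (le_ciSup (Estep_mem f₂ m).2 i)))
    (fun c f => by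
      refine ciSup_le fun i => ?_
      have := eTerm_lin φ m c f 0 i
      have h0 : eTerm φ m (0 : CSp n → ℂ) i = 0 := by simp [eTerm]
      rw [h0, add_zero, add_zero] at this
      exact this.trans (mul_le_mul_of_nonneg_left (le_ciSup (Estep_mem f m).2 i) (norm_nonneg c)))

/-- The norms `p_m`, `m = 0, 1, 2, …`, on `E(φ)`. -/
def eFamily (φ : (Fin n → ℝ) → ℝ) : SeminormFamily ℂ (Estep φ) ℕ := fun m => eSeminorm φ m

/-- The projective limit topology of `E(φ)`, i.e. the one defined by the norms `p_m`. -/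
abbrev eTopology (φ : (Fin n → ℝ) → ℝ) : TopologicalSpace (Estep φ) :=
  (eFamily φ).moduleFilterBasis.topology

/-! ### The steps increase -/

theorem gap_all (H : WeightFamily n) (ν : ℕ) :
    ∃ γ : ℝ, ∀ x, H.h (ν + 1) x ≤ H.h ν x + γ := by
  obtain ⟨γ, hγ⟩ := H.gap ν
  refine ⟨γ, fun x => ?_⟩
  rw [H.even (ν + 1) x, H.even ν x]
  have h1 := hγ (fun j => |x j|) fun j => abs_nonneg _
  have h2 : 0 ≤ Real.log 2 * ∑ j, |x j| :=
    mul_nonneg (Real.log_nonneg (by norm_num)) (Finset.sum_nonneg fun j _ => abs_nonneg _)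
  linarith

theorem bddAbove_conj (H : WeightFamily n) (ν : ℕ) (x : Fin n → ℝ) :
    BddAbove (Set.range fun y : Fin n → ℝ => ∑ j, x j * y j - H.h ν y) := by
  have h1 := (H.superlinear ν).eventually_ge_atTop (‖(WithLp.toLp 2 x : RSp n)‖ + 1)
  obtain ⟨K, hK, hKc⟩ := Filter.mem_cocompact.1 h1
  have hc : Continuous fun y : Fin n → ℝ => ∑ j, x j * y j := by fun_prop
  obtain ⟨B, hB⟩ := (hK.image hc).bddAbove
  refine ⟨max 0 (B - H.h ν 0), ?_⟩
  rintro _ ⟨y, rfl⟩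
  by_cases hy : y ∈ K
  · refine le_max_of_le_right ?_
    have h2 : H.h ν 0 ≤ H.h ν y := by
      rw [H.even ν y]
      exact H.mono ν (fun j => le_refl _) (fun j => abs_nonneg _) (fun j => abs_nonneg _)
    have h3 := hB ⟨y, hy, rfl⟩
    simp only at h3 ⊢
    linarith
  · refine le_max_of_le_left ?_
    have h2 : ‖(WithLp.toLp 2 x : RSp n)‖ + 1 ≤ H.h ν y / ‖(WithLp.toLp 2 y : RSp n)‖ := hKc hy
    have h3 : 0 < ‖(WithLp.toLp 2 y : RSp n)‖ := by
      rcases (norm_nonneg (WithLp.toLp 2 y : RSp n)).eq_or_lt with h | h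
      · rw [← h, div_zero] at h2
        linarith [norm_nonneg (WithLp.toLp 2 x : RSp n)]
      · exact h
    rw [le_div_iff₀ h3] at h2
    have h4 := real_inner_le_norm (WithLp.toLp 2 y : RSp n) (WithLp.toLp 2 x : RSp n)
    have h5 : inner ℝ (WithLp.toLp 2 y : RSp n) (WithLp.toLp 2 x : RSp n) = ∑ j, x j * y j := by
      simp [PiLp.inner_apply]
    rw [h5] at h4
    simp only
    nlinarith

theorem phi_le (H : WeightFamily n) (ν : ℕ) : ∃ γ : ℝ, ∀ x, phi H ν x ≤ phi H (ν + 1) x + γ := by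
  obtain ⟨γ, hγ⟩ := gap_all H ν
  refine ⟨γ, fun x => ciSup_le fun y => ?_⟩
  have h1 := le_ciSup (bddAbove_conj H (ν + 1) fun j => Real.log (1 + |x j|)) y
  have h2 := hγ y
  simp only [phi, conj] at h1 ⊢
  linarith

theorem Gstep_mono (H : WeightFamily n) : Monotone fun ν => Gstep (H.h ν) := by
  refine monotone_nat_of_le_succ fun ν => iInf_mono fun m => ?_
  obtain ⟨γ, hγ⟩ := gap_all H ν
  rintro f ⟨hf, hb⟩
  refine ⟨hf, bddAbove_lin (Real.exp_pos γ).le (fun i => ?_) hb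
    (v := fun _ => 0) ⟨0, by rintro _ ⟨i, rfl⟩; rfl⟩⟩
  have hw : indexWeight (H.h ν) i.2.1 ≤ Real.exp γ * indexWeight (H.h (ν + 1)) i.2.1 := by
    have e : Real.exp (-atIndex (H.h ν) i.2.1) ≤
        Real.exp γ * Real.exp (-atIndex (H.h (ν + 1)) i.2.1) := by
      rw [← Real.exp_add, Real.exp_le_exp]
      have := hγ fun j => (i.2.1 j : ℝ)
      simp only [atIndex]
      linarith
    have p : 0 ≤ multiFactorial i.2.1 := Finset.prod_nonneg fun j _ => Nat.cast_nonneg _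
    unfold indexWeight
    calc _ ≤ _ := mul_le_mul_of_nonneg_left e p
      _ = _ := by ring
  unfold gTerm
  rw [add_zero, ← mul_div_assoc, div_le_div_iff₀ (indexWeight_pos _ _) (indexWeight_pos _ _)]
  calc _ ≤ _ := mul_le_mul_of_nonneg_left hw (mul_nonneg (abs_nonneg _) (norm_nonneg _))
    _ = _ := by ring

theorem Estep_mono (H : WeightFamily n) : Monotone fun ν => Estep (phi H ν) := by
  refine monotone_nat_of_le_succ fun ν => iInf_mono fun m => ?_
  obtain ⟨γ, hγ⟩ := phi_le H ν
  rintro F ⟨hF, hb⟩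
  refine ⟨hF, bddAbove_lin (Real.exp_pos γ).le (fun z => ?_) hb
    (v := fun _ => 0) ⟨0, by rintro _ ⟨i, rfl⟩; rfl⟩⟩
  unfold eTerm
  rw [add_zero, ← mul_div_assoc, div_le_div_iff₀ (Real.exp_pos _) (Real.exp_pos _)]
  have e : Real.exp (phi H ν fun j => (z j).im) ≤
      Real.exp γ * Real.exp (phi H (ν + 1) fun j => (z j).im) := by
    rw [← Real.exp_add, Real.exp_le_exp]
    linarith [hγ fun j => (z j).im]
  calc _ ≤ _ := mul_le_mul_of_nonneg_left e (by positivity)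
    _ = _ := by ring

/-- The union of an increasing sequence of submodules, as a submodule. -/
def unionSubmodule {X : Type*} [AddCommGroup X] [Module ℂ X] (S : ℕ → Submodule ℂ X)
    (hS : Monotone S) : Submodule ℂ X where
  carrier := {f | ∃ ν, f ∈ S ν}
  zero_mem' := ⟨0, (S 0).zero_mem⟩
  add_mem' := by
    rintro f₁ f₂ ⟨ν₁, h₁⟩ ⟨ν₂, h₂⟩
    exact ⟨max ν₁ ν₂, (S _).add_mem (hS (le_max_left _ _) h₁) (hS (le_max_right _ _) h₂)⟩
  smul_mem' := by
    rintro c f ⟨ν, h⟩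
    exact ⟨ν, (S ν).smul_mem c h⟩

/-- The (locally convex) inductive limit topology on `X` with respect to linear maps
`ι ν : S ν → X`: the finest locally convex vector space topology on `X` that makes every `ι ν`
continuous.  (In Mathlib's order on topologies, finer is smaller.) -/
abbrev inductiveLimitTopology {X : Type*} [AddCommGroup X] [Module ℂ X] {S : ℕ → Type*}
    [∀ ν, AddCommGroup (S ν)] [∀ ν, Module ℂ (S ν)] (t : ∀ ν, TopologicalSpace (S ν))
    (ι : ∀ ν, S ν →ₗ[ℂ] X) : TopologicalSpace X :=
  sInf {τ : TopologicalSpace X | (∀ ν, @Continuous _ _ (t ν) τ (ι ν)) ∧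
    @IsTopologicalAddGroup X τ _ ∧ @ContinuousSMul ℂ X _ _ τ ∧
    @LocallyConvexSpace ℝ X _ _ _ _ τ}

/-! ### The spaces `G(H)` and `E(Φ)`

They are type synonyms, so that they do not inherit the topology of pointwise convergence. -/

/-- `G(H) = ⋃_ν G(h_ν)`. -/
def GSpace (H : WeightFamily n) : Type := unionSubmodule (fun ν => Gstep (H.h ν)) (Gstep_mono H)

instance (H : WeightFamily n) : AddCommGroup (GSpace H) :=
  inferInstanceAs (AddCommGroup (unionSubmodule (fun ν => Gstep (H.h ν)) (Gstep_mono H)))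

instance (H : WeightFamily n) : Module ℂ (GSpace H) :=
  inferInstanceAs (Module ℂ (unionSubmodule (fun ν => Gstep (H.h ν)) (Gstep_mono H)))

/-- The inclusion `G(h_ν) → G(H)`. -/
def GSpace.incl (H : WeightFamily n) (ν : ℕ) : Gstep (H.h ν) →ₗ[ℂ] GSpace H where
  toFun f := ⟨f.1, ⟨ν, f.2⟩⟩
  map_add' _ _ := rfl
  map_smul' _ _ := rfl

/-- The inductive limit topology of `G(H)`. -/
instance (H : WeightFamily n) : TopologicalSpace (GSpace H) :=
  inductiveLimitTopology (fun ν => gTopology (H.h ν)) (GSpace.incl H)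

/-- The function on `ℝⁿ` underlying an element of `G(H)`. -/
def GSpace.fn {H : WeightFamily n} (f : GSpace H) : RSp n → ℂ := Subtype.val f

/-- `E(Φ) = ⋃_ν E(φ_ν)`. -/
def ESpace (H : WeightFamily n) : Type := unionSubmodule (fun ν => Estep (phi H ν)) (Estep_mono H)

instance (H : WeightFamily n) : AddCommGroup (ESpace H) :=
  inferInstanceAs (AddCommGroup (unionSubmodule (fun ν => Estep (phi H ν)) (Estep_mono H)))

instance (H : WeightFamily n) : Module ℂ (ESpace H) :=
  inferInstanceAs (Module ℂ (unionSubmodule (fun ν => Estep (phi H ν)) (Estep_mono H)))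

/-- The inclusion `E(φ_ν) → E(Φ)`. -/
def ESpace.incl (H : WeightFamily n) (ν : ℕ) : Estep (phi H ν) →ₗ[ℂ] ESpace H where
  toFun F := ⟨F.1, ⟨ν, F.2⟩⟩
  map_add' _ _ := rfl
  map_smul' _ _ := rfl

/-- The inductive limit topology of `E(Φ)`. -/
instance (H : WeightFamily n) : TopologicalSpace (ESpace H) :=
  inductiveLimitTopology (fun ν => eTopology (phi H ν)) (ESpace.incl H)

/-- The entire function on `ℂⁿ` underlying an element of `E(Φ)`. -/
def ESpace.fn {H : WeightFamily n} (F : ESpace H) : CSp n → ℂ := Subtype.val F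

/-! ### The Fourier transform and the holomorphic extension map -/

/-- The Fourier transform `(2π)^{-n/2} ∫ f(ξ) e^{i⟨x, ξ⟩} dξ`. -/
def fourierT (f : RSp n → ℂ) (x : RSp n) : ℂ :=
  1 / ((Real.sqrt (2 * Real.pi) : ℝ) : ℂ) ^ n *
    ∫ ξ : RSp n, f ξ * Complex.exp (Complex.I * ((∑ j, x j * ξ j : ℝ) : ℂ))

/-- The set underlying `𝓔(H) = ⋃_ν ⋂_m 𝓔_m(h_ν)`: the functions `f ∈ C^∞(ℝⁿ)` such that for some
`ν` and all `m`, `(1 + ‖x‖)^m |(D^α f)(x)| / (α! e^{-h_ν(α)})` is bounded in `x` and `α`. -/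
def calE (H : WeightFamily n) : Set (RSp n → ℂ) :=
  {f | ∃ ν, ∀ m : ℕ, ContDiff ℝ ((⊤ : ℕ∞) : WithTop ℕ∞) f ∧
    BddAbove (Set.range fun i : RSp n × (Fin n → ℕ) =>
      (1 + ‖i.1‖) ^ m * ‖multiDeriv i.2 f i.1‖ / indexWeight (H.h ν) i.2)}

/-- The term `(D^α f)(0) / α! · z^α` of the Taylor series of `f` at `0`. -/
def taylorTerm (f : RSp n → ℂ) (z : CSp n) (α : Fin n → ℕ) : ℂ :=
  multiDeriv α f 0 / (multiFactorial α : ℂ) * ∏ j, z j ^ α j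

/-- The map `𝒜 : 𝓔(H) → {functions on ℂⁿ}` which sends `f` to the sum of its Taylor series. -/
def extensionMap (H : WeightFamily n) (f : calE H) (z : CSp n) : ℂ :=
  ∑' α : Fin n → ℕ, taylorTerm f.1 z α

end PaleyWiener

end

/-!
# The transform of a space of rapidly decreasing functions onto a space of entire functions

Both spaces can be described by exponential estimates. For `f ∈ G(h_ν)`, multiplying the bounds
`|ξ^β D^α f(ξ)| ≤ C β! e^{-h_ν(β)}` by `∏ (1 + t_j)^{β_j} / β!` and summing over `β` gives
`|D^α f(ξ)| ≤ C e^{φ_{ν+1}(t)} e^{-∑ (1 + t_j) |ξ_j|}` for all `t ≥ 0`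
(`norm_multiDeriv_mul_exp_le`); the gap condition makes the series converge. Conversely, bounds
`|D^α f(ξ)| ≤ C e^{φ_ν(t)} e^{-∑ t_j |ξ_j|}` for all `t` return the weighted estimates with
`h_{ν+1}`, because `sup_t (⟨β, ln t⟩ - φ_ν(t))` is at least `h_{ν+1}(β)` up to a constant
(`exists_phi_sub_le`, `gTerm_le_of_exp_decay`); this is biconjugation for the convex weight.

Hence `F(z) = (2π)^{-n/2} ∫ f(ξ) e^{i⟨z, ξ⟩} dξ` is entire for `f ∈ G(h_ν)`, and integration by parts
bounds it in `E(φ_{ν+1})` (`eTerm_laplace_le`). Expanding the exponential kernel shows that `F` is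
the sum of the Taylor series of `𝓕 f` (`hasSum_taylorTerm_fourierT`), and Cauchy's estimates for `F`
on polydiscs put `𝓕 f` into `𝓔(H)` (`fourierT_mem_calE`); here the subadditivity condition absorbs
polynomial factors (`phi_add_log_le`).

For `F ∈ E(φ_ν)` the inverse transform is an integral over `ℝⁿ` which may be moved to `ℝⁿ + iη`
(`integral_complexify_add_I_smul`). Choosing the signs of `η` according to those of `ξ` gives the
exponential estimates, hence the inverse transform lies in `G(h_{ν+1})`
(`gTerm_fourierT_complexify_le`). Fourier inversion and the uniqueness of holomorphic extensions
show that the two maps are mutually inverse. All estimates are linear in the seminorms, so the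
universal property of the inductive limit (`continuous_of_inductiveLimit`) gives continuity in
both directions.
-/

namespace PaleyWiener

variable {n : ℕ}

/-! ### The weights and their conjugates -/

theorem le_conj (H : WeightFamily n) (ν : ℕ) (x y : Fin n → ℝ) :
    ∑ j, x j * y j - H.h ν y ≤ conj (H.h ν) x :=
  le_ciSup (bddAbove_conj H ν x) y

theorem gap_abs (H : WeightFamily n) (ν : ℕ) :
    ∃ γ : ℝ, ∀ y : Fin n → ℝ, H.h (ν + 1) y + Real.log 2 * ∑ j, |y j| ≤ H.h ν y + γ := by
  obtain ⟨γ, hγ⟩ := H.gap ν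
  refine ⟨γ, fun y => ?_⟩
  have h1 := hγ (fun j => |y j|) fun j => abs_nonneg _
  rw [H.even (ν + 1) y, H.even ν y]
  linarith

/-- The gap condition `h_ν - h_{ν+1} ≥ ln 2 · ∑ x_j - γ` lets one enlarge the argument of the
conjugate by `ln 2` at the cost of one step in the family. -/
theorem conj_le_conj_succ (H : WeightFamily n) (ν : ℕ) :
    ∃ γ : ℝ, ∀ s s' : Fin n → ℝ, (∀ j, 0 ≤ s j) → (∀ j, s j ≤ s' j + Real.log 2) →
      (∀ j, 0 ≤ s' j) → conj (H.h ν) s ≤ conj (H.h (ν + 1)) s' + γ := by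
  obtain ⟨γ, hγ⟩ := gap_abs H ν
  refine ⟨γ, fun s s' hs hss' hs' => ciSup_le fun y => ?_⟩
  have h1 := hγ y
  have h2 := le_conj H (ν + 1) s' (fun j => |y j|)
  rw [← H.even] at h2
  have h3 : ∑ j, s j * y j ≤ ∑ j, s' j * |y j| + Real.log 2 * ∑ j, |y j| := by
    rw [Finset.mul_sum, ← Finset.sum_add_distrib]
    refine Finset.sum_le_sum fun j _ => ?_
    calc s j * y j ≤ s j * |y j| := mul_le_mul_of_nonneg_left (le_abs_self _) (hs j)
      _ ≤ (s' j + Real.log 2) * |y j| := mul_le_mul_of_nonneg_right (hss' j) (abs_nonneg _)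
      _ = _ := by ring
  linarith

theorem conj_mono (H : WeightFamily n) (ν : ℕ) {s s' : Fin n → ℝ} (hs : ∀ j, 0 ≤ s j)
    (h : ∀ j, s j ≤ s' j) : conj (H.h ν) s ≤ conj (H.h ν) s' := by
  refine ciSup_le fun y => ?_
  have h2 := le_conj H ν s' (fun j => |y j|)
  rw [← H.even] at h2
  have h3 : ∑ j, s j * y j ≤ ∑ j, s' j * |y j| := Finset.sum_le_sum fun j _ =>
    (mul_le_mul_of_nonneg_left (le_abs_self _) (hs j)).trans
      (mul_le_mul_of_nonneg_right (h j) (abs_nonneg _))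
  linarith

theorem log_one_add_abs_nonneg (t : ℝ) : 0 ≤ Real.log (1 + |t|) :=
  Real.log_nonneg (by linarith [abs_nonneg t])

theorem phi_mono (H : WeightFamily n) (ν : ℕ) {t t' : Fin n → ℝ} (h : ∀ j, |t j| ≤ |t' j|) :
    phi H ν t ≤ phi H ν t' :=
  conj_mono H ν (fun j => log_one_add_abs_nonneg _) fun j =>
    Real.log_le_log (by linarith [abs_nonneg (t j)]) (by linarith [h j])

/-- Biconjugation up to a constant, with nonnegative slopes: since `h_ν` is convex and continuous,
an affine function below `h_ν` comes within `1` of it at `b`; as `h_ν` is even and increasing, its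
negative slopes can be replaced by `0`. -/
theorem exists_nonneg_slope (H : WeightFamily n) (ν : ℕ) {b : Fin n → ℝ} (hb : ∀ j, 0 ≤ b j) :
    ∃ s : Fin n → ℝ, (∀ j, 0 ≤ s j) ∧ conj (H.h ν) s ≤ ∑ j, s j * b j - H.h ν b + 1 := by
  have hcont : Continuous (H.h ν) := (H.convex ν).locallyLipschitz.continuous
  obtain ⟨l, c, h1, h2⟩ := ConvexOn.exists_affine_le_of_lt (𝕜 := ℝ) (Set.mem_univ b)
    (sub_one_lt (H.h ν b)) isClosed_univ (hcont.lowerSemicontinuous.lowerSemicontinuousOn _)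
    (H.convex ν)
  have hl : ∀ y, l y = ∑ j, l (Pi.single j 1) * y j := fun y => by
    conv_lhs => rw [← Finset.univ_sum_single y]
    rw [map_sum]
    refine Finset.sum_congr rfl fun j _ => ?_
    have : (Pi.single j (y j) : Fin n → ℝ) = y j • Pi.single j 1 := by
      rw [← Pi.single_smul, smul_eq_mul, mul_one]
    rw [this, map_smul, smul_eq_mul, mul_comm]
  have h1' : ∀ y, l y + c ≤ H.h ν y := fun y => by simpa using h1 ⟨y, Set.mem_univ y⟩
  simp only [RCLike.re_to_real] at h2
  refine ⟨fun j => max (l (Pi.single j 1)) 0, fun j => le_max_right _ _, ciSup_le fun y => ?_⟩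
  have h3 : H.h ν (fun j => if 0 ≤ l (Pi.single j 1) then y j else 0) ≤ H.h ν y := by
    rw [H.even ν y, H.even]
    refine H.mono ν (fun j => abs_nonneg _) (fun j => abs_nonneg _) fun j => ?_
    dsimp only
    split_ifs <;> simp
  have h4 := h1' (fun j => if 0 ≤ l (Pi.single j 1) then y j else 0)
  rw [hl] at h4
  have h5 : ∑ j, max (l (Pi.single j 1)) 0 * y j =
      ∑ j, l (Pi.single j 1) * (if 0 ≤ l (Pi.single j 1) then y j else 0) := by
    refine Finset.sum_congr rfl fun j _ => ?_
    split_ifs with h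
    · rw [max_eq_left h]
    · rw [max_eq_right (not_le.1 h).le]; simp
  have h6 : l b ≤ ∑ j, max (l (Pi.single j 1)) 0 * b j := by
    rw [hl]
    exact Finset.sum_le_sum fun j _ => mul_le_mul_of_nonneg_right (le_max_left _ _) (hb j)
  linarith

/-- The lower bound for `sup_t (⟨β, ln t⟩ - φ_ν(t))` that turns exponential estimates into weighted
estimates indexed by `β`. -/
theorem exists_phi_sub_le (H : WeightFamily n) (ν : ℕ) :
    ∃ C : ℝ, ∀ b : Fin n → ℝ, (∀ j, 0 ≤ b j) → ∃ s : Fin n → ℝ,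
      phi H ν (fun j => Real.exp (s j)) ≤ ∑ j, s j * b j - H.h (ν + 1) b + C := by
  obtain ⟨γ, hγ⟩ := conj_le_conj_succ H ν
  refine ⟨1 + γ, fun b hb => ?_⟩
  obtain ⟨s, hs, h⟩ := exists_nonneg_slope H (ν + 1) hb
  refine ⟨s, ?_⟩
  have h1 := hγ (fun j => Real.log (1 + |Real.exp (s j)|)) s
    (fun j => log_one_add_abs_nonneg _) (fun j => ?_) hs
  · unfold phi
    linarith
  · rw [abs_of_pos (Real.exp_pos _)]
    have h2 : Real.log (1 + Real.exp (s j)) ≤ Real.log (Real.exp (s j) * 2) :=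
      Real.log_le_log (by positivity) (by linarith [Real.one_le_exp (hs j)])
    rwa [Real.log_mul (Real.exp_ne_zero _) two_ne_zero, Real.log_exp] at h2

/-- Polynomial factors are absorbed by one step in the family, by the subadditivity condition. -/
theorem phi_add_log_le (H : WeightFamily n) (ν m : ℕ) :
    ∃ C : ℝ, ∀ t : Fin n → ℝ,
      phi H ν t + m * ∑ j, Real.log (1 + |t j|) ≤ phi H (ν + 1) t + C := by
  obtain ⟨l, hl⟩ := H.subadd ν
  refine ⟨H.h ν (fun _ => (m : ℝ)) + l, fun t => ?_⟩
  rw [← le_sub_iff_add_le]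
  refine ciSup_le fun y => ?_
  have h1 := hl (fun j => |y j|) (fun _ => (m : ℝ)) (fun j => abs_nonneg _)
    fun _ => Nat.cast_nonneg m
  rw [← H.even] at h1
  have h2 := le_conj H (ν + 1) (fun j => Real.log (1 + |t j|))
    ((fun j => |y j|) + fun _ => (m : ℝ))
  have h3 : ∑ j, Real.log (1 + |t j|) * y j ≤ ∑ j, Real.log (1 + |t j|) * |y j| :=
    Finset.sum_le_sum fun j _ =>
      mul_le_mul_of_nonneg_left (le_abs_self _) (log_one_add_abs_nonneg _)
  have h4 : ∑ j, Real.log (1 + |t j|) * (((fun j => |y j|) + fun _ => (m : ℝ) : Fin n → ℝ) j) =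
      ∑ j, Real.log (1 + |t j|) * |y j| + m * ∑ j, Real.log (1 + |t j|) := by
    rw [Finset.mul_sum, ← Finset.sum_add_distrib]
    exact Finset.sum_congr rfl fun j _ => by simp only [Pi.add_apply]; ring
  unfold phi
  linarith

theorem norm_le_sum_norm {𝕜 : Type*} [RCLike 𝕜] (w : EuclideanSpace 𝕜 (Fin n)) :
    ‖w‖ ≤ ∑ j, ‖w j‖ := by
  conv_lhs => rw [← (EuclideanSpace.basisFun (Fin n) 𝕜).sum_repr w]
  refine (norm_sum_le _ _).trans (le_of_eq (Finset.sum_congr rfl fun j _ => ?_))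
  simp [norm_smul]

theorem one_add_norm_le_prod {𝕜 : Type*} [RCLike 𝕜] (w : EuclideanSpace 𝕜 (Fin n)) :
    1 + ‖w‖ ≤ ∏ j, (1 + ‖w j‖) := by
  refine (add_le_add_right (norm_le_sum_norm w) 1).trans ?_
  generalize (Finset.univ : Finset (Fin n)) = S
  induction S using Finset.induction_on with
  | empty => simp
  | insert i S hi ih =>
    rw [Finset.sum_insert hi, Finset.prod_insert hi]
    have h2 : 0 ≤ ∑ j ∈ S, ‖w j‖ := Finset.sum_nonneg fun j _ => norm_nonneg _
    nlinarith [norm_nonneg (w i)]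

/-! ### Sums over multi-indices -/

/-- A product of absolutely convergent series is a series over multi-indices. -/
theorem hasSum_prod_pi {𝕜 : Type*} [RCLike 𝕜] : ∀ {n : ℕ} (u : Fin n → ℕ → 𝕜),
    (∀ j, Summable fun k => ‖u j k‖) →
    Summable (fun β : Fin n → ℕ => ‖∏ j, u j (β j)‖) ∧
      ∑' β : Fin n → ℕ, ∏ j, u j (β j) = ∏ j, ∑' k, u j k
  | 0, u, _ => by
    refine ⟨?_, ?_⟩
    · exact (hasSum_fintype _).summable
    · simp
  | n + 1, u, hu => by
    obtain ⟨h1, h2⟩ := hasSum_prod_pi (fun j => u j.succ) fun j => hu j.succ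
    let e := Fin.consEquiv (fun _ : Fin (n + 1) => ℕ)
    have he : ∀ p : ℕ × (Fin n → ℕ), ∏ j, u j (e p j) = u 0 p.1 * ∏ j, u j.succ (p.2 j) :=
      fun p => by simp [e, Fin.prod_univ_succ, Fin.consEquiv]
    refine ⟨?_, ?_⟩
    · rw [← e.summable_iff]
      refine ((hu 0).mul_norm h1).congr fun p => ?_
      simp only [Function.comp_apply, he]
    · rw [← e.tsum_eq, Fin.prod_univ_succ, ← h2]
      simp only [he]
      exact (tsum_mul_tsum_of_summable_norm (hu 0) h1).symm

/-- The sum of `2^{-|β|}` over all multi-indices. -/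
theorem summable_half_pow (n : ℕ) :
    Summable fun β : Fin n → ℕ => ∏ j, ((1 : ℝ) / 2) ^ β j := by
  have h := (hasSum_prod_pi (𝕜 := ℝ) (fun (_ : Fin n) k => ((1 : ℝ) / 2) ^ k) fun j => by
    simpa using summable_geometric_two).1
  exact h.of_norm

/-! ### Weighted estimates and exponential estimates -/

theorem prod_pow_mul_exp_le (H : WeightFamily n) (ν : ℕ) :
    ∃ C : ℝ, 0 < C ∧ ∀ (t : Fin n → ℝ) (β : Fin n → ℕ),
      (∏ j, (1 + |t j|) ^ β j) * Real.exp (-atIndex (H.h ν) β) ≤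
        C * Real.exp (phi H (ν + 1) t) * ∏ j, ((1 : ℝ) / 2) ^ β j := by
  obtain ⟨γ, hγ⟩ := gap_abs H ν
  refine ⟨Real.exp γ, Real.exp_pos _, fun t β => ?_⟩
  have h1 := hγ (fun j => (β j : ℝ))
  have h2 := le_conj H (ν + 1) (fun j => Real.log (1 + |t j|)) (fun j => (β j : ℝ))
  have e1 : ∏ j, (1 + |t j|) ^ β j = Real.exp (∑ j, Real.log (1 + |t j|) * β j) := by
    rw [Real.exp_sum]
    refine Finset.prod_congr rfl fun j _ => ?_
    rw [mul_comm, Real.exp_nat_mul, Real.exp_log (by positivity)]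
  have e2 : ∏ j, ((1 : ℝ) / 2) ^ β j = Real.exp (-(Real.log 2 * ∑ j, |(β j : ℝ)|)) := by
    rw [Finset.mul_sum, ← Finset.sum_neg_distrib, Real.exp_sum]
    refine Finset.prod_congr rfl fun j _ => ?_
    rw [Nat.abs_cast, ← neg_mul, mul_comm, Real.exp_nat_mul, Real.exp_neg,
      Real.exp_log two_pos, one_div]
  rw [e1, e2, ← Real.exp_add, ← Real.exp_add, ← Real.exp_add, Real.exp_le_exp]
  simp only [atIndex, phi]
  linarith

theorem gTerm_le_gNorm {g : (Fin n → ℝ) → ℝ} {m : ℕ} {f : RSp n → ℂ} (hf : f ∈ Gm g m)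
    (i : GIndex n m) : gTerm g m f i ≤ gNorm g m f :=
  le_ciSup hf.2 i

theorem gNorm_nonneg (g : (Fin n → ℝ) → ℝ) (m : ℕ) (f : RSp n → ℂ) : 0 ≤ gNorm g m f :=
  Real.iSup_nonneg fun i => gTerm_nonneg g m f i

theorem eTerm_le_eNorm {φ : (Fin n → ℝ) → ℝ} {m : ℕ} {F : CSp n → ℂ} (hF : F ∈ Em φ m)
    (z : CSp n) : eTerm φ m F z ≤ eNorm φ m F :=
  le_ciSup hF.2 z

theorem eNorm_nonneg (φ : (Fin n → ℝ) → ℝ) (m : ℕ) (F : CSp n → ℂ) : 0 ≤ eNorm φ m F :=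
  Real.iSup_nonneg fun i => eTerm_nonneg φ m F i

theorem summable_exp_series (a : ℝ) :
    Summable (fun k : ℕ => ‖a ^ k / (k.factorial : ℝ)‖) :=
  (NormedSpace.norm_expSeries_div_summable (𝔸 := ℝ) a)

theorem tsum_exp_series (a : ℝ) : ∑' k : ℕ, a ^ k / (k.factorial : ℝ) = Real.exp a := by
  rw [Real.exp_eq_exp_ℝ, NormedSpace.exp_eq_tsum_div]

/-- An element of `G_m(h_ν)` decays, together with its derivatives, faster than every exponential;
this follows by summing the defining estimates over all `β` against the exponential series. -/
theorem norm_multiDeriv_mul_exp_le (H : WeightFamily n) (ν : ℕ) :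
    ∃ C : ℝ, 0 < C ∧ ∀ (m : ℕ) (f : RSp n → ℂ), f ∈ Gm (H.h ν) m → ∀ α : Fin n → ℕ,
      ∑ j, α j ≤ m → ∀ (t : Fin n → ℝ) (ξ : RSp n),
        ‖multiDeriv α f ξ‖ * Real.exp (∑ j, (1 + |t j|) * |ξ j|) ≤
          C * gNorm (H.h ν) m f * Real.exp (phi H (ν + 1) t) := by
  obtain ⟨C, hC, hCt⟩ := prod_pow_mul_exp_le H ν
  have hS : 0 ≤ ∑' β : Fin n → ℕ, ∏ j, ((1 : ℝ) / 2) ^ β j :=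
    tsum_nonneg fun β => by positivity
  refine ⟨C * (∑' β : Fin n → ℕ, ∏ j, ((1 : ℝ) / 2) ^ β j + 1), by positivity,
    fun m f hf α hα t ξ => ?_⟩
  obtain ⟨h1, h2⟩ := hasSum_prod_pi
    (fun j k => ((1 + |t j|) * |ξ j|) ^ k / (k.factorial : ℝ)) fun j => summable_exp_series _
  simp only [tsum_exp_series] at h2
  rw [Real.exp_sum, ← h2, ← tsum_mul_left]
  have key : ∀ β : Fin n → ℕ, ‖multiDeriv α f ξ‖ *
      ∏ j, ((1 + |t j|) * |ξ j|) ^ β j / ((β j).factorial : ℝ) ≤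
      C * gNorm (H.h ν) m f * Real.exp (phi H (ν + 1) t) * ∏ j, ((1 : ℝ) / 2) ^ β j := by
    intro β
    have h3 := gTerm_le_gNorm hf (ξ, β, ⟨α, hα⟩)
    simp only [gTerm] at h3
    rw [div_le_iff₀ (indexWeight_pos _ _), indexWeight] at h3
    have hfac : 0 < multiFactorial β :=
      Finset.prod_pos fun j _ => by exact_mod_cast (β j).factorial_pos
    have e : ∏ j, ((1 + |t j|) * |ξ j|) ^ β j / ((β j).factorial : ℝ) =
        (∏ j, (1 + |t j|) ^ β j) * |∏ j, ξ j ^ β j| / multiFactorial β := by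
      rw [Finset.prod_div_distrib, Finset.abs_prod, ← Finset.prod_mul_distrib, multiFactorial]
      simp only [mul_pow, abs_pow]
    have h4 := mul_le_mul_of_nonneg_left h3
      (Finset.prod_nonneg fun j _ => by positivity : 0 ≤ ∏ j, (1 + |t j|) ^ β j)
    have h5 := mul_le_mul_of_nonneg_left (hCt t β) (gNorm_nonneg (H.h ν) m f)
    rw [e, ← mul_div_assoc, div_le_iff₀ hfac]
    calc _ = (∏ j, (1 + |t j|) ^ β j) * (|∏ j, ξ j ^ β j| * ‖multiDeriv α f ξ‖) := by ring
      _ ≤ _ := h4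
      _ = gNorm (H.h ν) m f * ((∏ j, (1 + |t j|) ^ β j) * Real.exp (-atIndex (H.h ν) β)) *
          multiFactorial β := by ring
      _ ≤ _ := mul_le_mul_of_nonneg_right h5 hfac.le
      _ = _ := by ring
  have hsum := (summable_half_pow n).mul_left
    (C * gNorm (H.h ν) m f * Real.exp (phi H (ν + 1) t))
  have hle := Summable.tsum_le_tsum key (h1.of_norm.mul_left _) hsum
  rw [tsum_mul_left (a := C * _ * _)] at hle
  refine hle.trans ?_
  have := mul_nonneg (mul_nonneg hC.le (gNorm_nonneg (H.h ν) m f))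
    (Real.exp_pos (phi H (ν + 1) t)).le
  nlinarith

/-- Exponential decay with rates `e^{s_j}` and constants `e^{φ_ν(e^s)}`, for all `s`, gives the
weighted estimates of `G(h_{ν+1})`: for given `β` one chooses `s` almost optimally. -/
theorem gTerm_le_of_exp_decay (H : WeightFamily n) (ν : ℕ) :
    ∃ C : ℝ, 0 < C ∧ ∀ (ξ : RSp n) (D A : ℝ), 0 ≤ D → 0 ≤ A →
      (∀ s : Fin n → ℝ, D * Real.exp (∑ j, Real.exp (s j) * |ξ j|) ≤
        A * Real.exp (phi H ν fun j => Real.exp (s j))) →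
      ∀ β : Fin n → ℕ, |∏ j, ξ j ^ β j| * D / indexWeight (H.h (ν + 1)) β ≤ C * A := by
  obtain ⟨c, hc⟩ := exists_phi_sub_le H ν
  refine ⟨Real.exp c, Real.exp_pos _, fun ξ D A hD hA h β => ?_⟩
  obtain ⟨s, hs⟩ := hc (fun j => (β j : ℝ)) fun j => Nat.cast_nonneg _
  have hfac : 0 < multiFactorial β :=
    Finset.prod_pos fun j _ => by exact_mod_cast (β j).factorial_pos
  have h1 : |∏ j, ξ j ^ β j| ≤ multiFactorial β * Real.exp (-∑ j, s j * β j) *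
      Real.exp (∑ j, Real.exp (s j) * |ξ j|) := by
    rw [Finset.abs_prod, ← Finset.sum_neg_distrib, Real.exp_sum, Real.exp_sum, multiFactorial,
      ← Finset.prod_mul_distrib, ← Finset.prod_mul_distrib]
    refine Finset.prod_le_prod (fun j _ => abs_nonneg _) fun j _ => ?_
    have h2 := Real.pow_div_factorial_le_exp (x := Real.exp (s j) * |ξ j|) (by positivity) (β j)
    have h3 : (0 : ℝ) < (β j).factorial := by exact_mod_cast (β j).factorial_pos
    rw [div_le_iff₀ h3, mul_pow, ← Real.exp_nat_mul] at h2
    have h4 : Real.exp (-(s j * β j)) * Real.exp (β j * s j) = 1 := by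
      rw [← Real.exp_add, mul_comm, neg_add_cancel, Real.exp_zero]
    calc |ξ j ^ β j| = Real.exp (-(s j * β j)) * (Real.exp (β j * s j) * |ξ j| ^ β j) := by
          rw [← mul_assoc, h4, one_mul, abs_pow]
      _ ≤ Real.exp (-(s j * β j)) * (Real.exp (Real.exp (s j) * |ξ j|) * (β j).factorial) :=
          mul_le_mul_of_nonneg_left h2 (Real.exp_pos _).le
      _ = _ := by ring
  rw [div_le_iff₀ (indexWeight_pos _ _), indexWeight]
  have h5 : Real.exp (-∑ j, s j * (β j : ℝ)) * Real.exp (phi H ν fun j => Real.exp (s j)) ≤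
      Real.exp c * Real.exp (-atIndex (H.h (ν + 1)) β) := by
    rw [← Real.exp_add, ← Real.exp_add, Real.exp_le_exp, atIndex]
    linarith
  calc |∏ j, ξ j ^ β j| * D ≤ _ := mul_le_mul_of_nonneg_right h1 hD
    _ = multiFactorial β * Real.exp (-∑ j, s j * β j) *
        (D * Real.exp (∑ j, Real.exp (s j) * |ξ j|)) := by ring
    _ ≤ multiFactorial β * Real.exp (-∑ j, s j * β j) *
        (A * Real.exp (phi H ν fun j => Real.exp (s j))) :=
        mul_le_mul_of_nonneg_left (h s) (by positivity)
    _ = multiFactorial β * A * (Real.exp (-∑ j, s j * β j) *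
        Real.exp (phi H ν fun j => Real.exp (s j))) := by ring
    _ ≤ multiFactorial β * A * (Real.exp c * Real.exp (-atIndex (H.h (ν + 1)) β)) :=
        mul_le_mul_of_nonneg_left h5 (by positivity)
    _ = _ := by ring

/-! ### The Fourier–Laplace transform -/

/-- The embedding `ℝⁿ ⊆ ℂⁿ`. -/
def complexify (x : RSp n) : CSp n := WithLp.toLp 2 fun j => (x j : ℂ)

@[simp] theorem complexify_apply (x : RSp n) (j : Fin n) : complexify x j = (x j : ℂ) := rfl

theorem norm_complexify (x : RSp n) : ‖complexify x‖ = ‖x‖ := by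
  simp [EuclideanSpace.norm_eq]

theorem continuous_complexify : Continuous (complexify : RSp n → CSp n) :=
  (PiLp.continuous_toLp 2 _).comp (by fun_prop)

/-- The linear form `z ↦ ⟨z, ξ⟩ = ∑ z_j ξ_j` on `ℂⁿ`. -/
noncomputable def pairing (ξ : RSp n) : CSp n →L[ℂ] ℂ := ∑ j, (ξ j : ℂ) • EuclideanSpace.proj j

theorem pairing_apply (ξ : RSp n) (z : CSp n) : pairing ξ z = ∑ j, z j * (ξ j : ℂ) := by
  simp [pairing, mul_comm]

theorem norm_pairing_apply_le (ξ : RSp n) (z : CSp n) : ‖pairing ξ z‖ ≤ ‖ξ‖ * ‖z‖ := by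
  have h : pairing ξ z = inner ℂ (complexify ξ) z := by
    rw [pairing_apply, PiLp.inner_apply]
    simp
  rw [h, ← norm_complexify ξ]
  exact norm_inner_le_norm _ _

theorem norm_pairing_le (ξ : RSp n) : ‖pairing ξ‖ ≤ ‖ξ‖ :=
  ContinuousLinearMap.opNorm_le_bound _ (norm_nonneg _) (norm_pairing_apply_le ξ)

theorem continuous_pairing : Continuous (pairing : RSp n → CSp n →L[ℂ] ℂ) := by
  unfold pairing
  fun_prop

theorem norm_exp_pairing (ξ : RSp n) (z : CSp n) :
    ‖Complex.exp (Complex.I * pairing ξ z)‖ = Real.exp (-∑ j, (z j).im * ξ j) := by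
  rw [Complex.norm_exp, pairing_apply]
  simp

theorem norm_exp_pairing_le (ξ : RSp n) (z : CSp n) :
    ‖Complex.exp (Complex.I * pairing ξ z)‖ ≤ Real.exp (‖z‖ * ‖ξ‖) := by
  refine (Complex.norm_exp_le_exp_norm _).trans (Real.exp_le_exp.2 ?_)
  rw [norm_mul, Complex.norm_I, one_mul, mul_comm]
  exact norm_pairing_apply_le ξ z

/-- The Fourier–Laplace transform `∫ f(ξ) e^{i⟨z, ξ⟩} dξ`, without normalising constant. -/
noncomputable def laplace (f : RSp n → ℂ) (z : CSp n) : ℂ :=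
  ∫ ξ, f ξ * Complex.exp (Complex.I * pairing ξ z)

/-- The normalising constant `(2π)^{-n/2}` of the Fourier transform. -/
noncomputable def fourierConst (n : ℕ) : ℂ := 1 / ((Real.sqrt (2 * Real.pi) : ℝ) : ℂ) ^ n

theorem fourierT_eq (f : RSp n → ℂ) (x : RSp n) :
    fourierT f x = fourierConst n * laplace f (complexify x) := by
  simp [fourierT, fourierConst, laplace, pairing_apply]

/-- The continuous functions that decay faster than every exponential `e^{-r‖ξ‖}`. -/
def HasExpDecay (f : RSp n → ℂ) : Prop :=
  Continuous f ∧ ∀ r : ℝ, ∃ A : ℝ, ∀ ξ, ‖f ξ‖ * Real.exp (r * ‖ξ‖) ≤ A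

theorem one_add_pow_le_exp (k : ℕ) {r : ℝ} (hr : 0 ≤ r) :
    (1 + r) ^ k ≤ k.factorial * Real.exp 1 * Real.exp r := by
  have h := Real.pow_div_factorial_le_exp (x := 1 + r) (by linarith) k
  have h3 : (0 : ℝ) < k.factorial := by exact_mod_cast k.factorial_pos
  rw [div_le_iff₀ h3, Real.exp_add] at h
  linarith

theorem integrable_one_add_norm_pow_inv :
    Integrable fun x : RSp n => ((1 + ‖x‖) ^ (n + 1))⁻¹ := by
  have h := integrable_one_add_norm (E := RSp n) (μ := volume) (r := (n + 1 : ℕ))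
    (by simp)
  refine h.congr (Eventually.of_forall fun x => ?_)
  simp only
  rw [Real.rpow_neg (by positivity), Real.rpow_natCast]

theorem integrable_exp_neg_norm : Integrable fun x : RSp n => Real.exp (-‖x‖) := by
  refine (integrable_one_add_norm_pow_inv.const_mul
    ((n + 1).factorial * Real.exp 1)).mono' (by fun_prop) (Eventually.of_forall fun x => ?_)
  have h := one_add_pow_le_exp (n + 1) (norm_nonneg x)
  rw [Real.norm_of_nonneg (Real.exp_pos _).le, Real.exp_neg, ← div_eq_mul_inv,
    inv_le_iff_one_le_mul₀ (Real.exp_pos _), ← mul_div_right_comm, le_div_iff₀ (by positivity)]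
  linarith

theorem HasExpDecay.integrable_mul_exp {f : RSp n → ℂ} (hf : HasExpDecay f) (r : ℝ) :
    Integrable fun ξ => ‖f ξ‖ * Real.exp (r * ‖ξ‖) := by
  obtain ⟨A, hA⟩ := hf.2 (r + 1)
  have := hf.1
  refine (integrable_exp_neg_norm.const_mul A).mono' (by fun_prop)
    (Eventually.of_forall fun ξ => ?_)
  rw [Real.norm_of_nonneg (by positivity), Real.exp_neg, ← div_eq_mul_inv,
    le_div_iff₀ (Real.exp_pos _), mul_assoc, ← Real.exp_add]
  have := hA ξ
  rwa [add_mul, one_mul] at this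

theorem HasExpDecay.integrable {f : RSp n → ℂ} (hf : HasExpDecay f) : Integrable f := by
  have h := hf.integrable_mul_exp 0
  simp only [zero_mul, Real.exp_zero, mul_one] at h
  exact (integrable_norm_iff hf.1.aestronglyMeasurable).1 h

theorem HasExpDecay.integrable_pow_norm_mul {f : RSp n → ℂ} (hf : HasExpDecay f) (k : ℕ) :
    Integrable fun ξ => ‖ξ‖ ^ k * ‖f ξ‖ := by
  have := hf.1
  refine ((hf.integrable_mul_exp 1).const_mul (k.factorial * Real.exp 1)).mono' (by fun_prop)
    (Eventually.of_forall fun ξ => ?_)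
  have h := one_add_pow_le_exp k (norm_nonneg ξ)
  have h1 : ‖ξ‖ ^ k ≤ (1 + ‖ξ‖) ^ k := by gcongr; linarith
  rw [Real.norm_of_nonneg (by positivity), one_mul]
  calc _ ≤ _ := mul_le_mul_of_nonneg_right (h1.trans h) (norm_nonneg _)
    _ = _ := by ring

theorem HasExpDecay.coord_mul {f : RSp n → ℂ} (hf : HasExpDecay f) (c : ℂ) (j : Fin n) :
    HasExpDecay fun ξ => c * (ξ j : ℂ) * f ξ := by
  have := hf.1
  refine ⟨by fun_prop, fun r => ?_⟩
  obtain ⟨A, hA⟩ := hf.2 (r + 1)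
  refine ⟨‖c‖ * A, fun ξ => ?_⟩
  have h1 : |ξ j| ≤ Real.exp ‖ξ‖ := by
    have h2 : |ξ j| ≤ ‖ξ‖ := PiLp.norm_apply_le ξ j
    linarith [Real.add_one_le_exp ‖ξ‖]
  have h2 := hA ξ
  rw [add_mul, one_mul, Real.exp_add] at h2
  rw [norm_mul, norm_mul, Complex.norm_real, Real.norm_eq_abs]
  calc ‖c‖ * |ξ j| * ‖f ξ‖ * Real.exp (r * ‖ξ‖)
      = ‖c‖ * (‖f ξ‖ * (Real.exp (r * ‖ξ‖) * |ξ j|)) := by ring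
    _ ≤ ‖c‖ * (‖f ξ‖ * (Real.exp (r * ‖ξ‖) * Real.exp ‖ξ‖)) := by gcongr
    _ ≤ _ := mul_le_mul_of_nonneg_left h2 (norm_nonneg _)

theorem HasExpDecay.integrable_laplace {f : RSp n → ℂ} (hf : HasExpDecay f) (z : CSp n) :
    Integrable fun ξ => f ξ * Complex.exp (Complex.I * pairing ξ z) := by
  have h1 := hf.1
  have h2 : Continuous fun ξ : RSp n => pairing ξ z := continuous_pairing.clm_apply continuous_const
  refine (hf.integrable_mul_exp ‖z‖).mono' (by fun_prop) (Eventually.of_forall fun ξ => ?_)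
  rw [norm_mul]
  exact mul_le_mul_of_nonneg_left (norm_exp_pairing_le ξ z) (norm_nonneg _)

/-- The Fourier–Laplace transform of a function of superexponential decay may be differentiated
under the integral sign. -/
theorem HasExpDecay.hasFDerivAt_laplace {f : RSp n → ℂ} (hf : HasExpDecay f) (z : CSp n) :
    Integrable (fun ξ => (f ξ * Complex.exp (Complex.I * pairing ξ z) * Complex.I) • pairing ξ) ∧
    HasFDerivAt (laplace f)
      (∫ ξ, (f ξ * Complex.exp (Complex.I * pairing ξ z) * Complex.I) • pairing ξ) z := by
  have h1 := hf.1
  have h2 : ∀ z : CSp n, Continuous fun ξ : RSp n => pairing ξ z :=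
    fun z => continuous_pairing.clm_apply continuous_const
  have hc := continuous_pairing (n := n)
  have hm : AEStronglyMeasurable
      (fun ξ => (f ξ * Complex.exp (Complex.I * pairing ξ z) * Complex.I) • pairing ξ) volume := by
    have := h2 z
    exact Continuous.aestronglyMeasurable (by fun_prop)
  have hle : ∀ ξ : RSp n, ∀ w ∈ Metric.ball z 1,
      ‖(f ξ * Complex.exp (Complex.I * pairing ξ w) * Complex.I) • pairing ξ‖ ≤
        ‖f ξ‖ * Real.exp ((‖z‖ + 2) * ‖ξ‖) := by
    intro ξ w hw
    have hw' : ‖w‖ ≤ ‖z‖ + 1 := by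
      have := norm_sub_norm_le w z
      rw [Metric.mem_ball, dist_eq_norm] at hw
      linarith
    rw [norm_smul, norm_mul, norm_mul, Complex.norm_I, mul_one]
    have e1 : ‖Complex.exp (Complex.I * pairing ξ w)‖ ≤ Real.exp ((‖z‖ + 1) * ‖ξ‖) :=
      (norm_exp_pairing_le ξ w).trans (Real.exp_le_exp.2 (by gcongr))
    have e2 : ‖pairing ξ‖ ≤ Real.exp ‖ξ‖ :=
      (norm_pairing_le ξ).trans (by linarith [Real.add_one_le_exp ‖ξ‖])
    have e3 : (‖z‖ + 2) * ‖ξ‖ = (‖z‖ + 1) * ‖ξ‖ + ‖ξ‖ := by ring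
    rw [e3, Real.exp_add, mul_assoc]
    gcongr
  refine ⟨(hf.integrable_mul_exp (‖z‖ + 2)).mono' hm
    (Eventually.of_forall fun ξ => hle ξ z (Metric.mem_ball_self one_pos)), ?_⟩
  refine hasFDerivAt_integral_of_dominated_of_fderiv_le
    (F := fun w ξ => f ξ * Complex.exp (Complex.I * pairing ξ w))
    (Metric.ball_mem_nhds z one_pos)
    (Eventually.of_forall fun w => (hf.integrable_laplace w).aestronglyMeasurable)
    (hf.integrable_laplace z) hm (Eventually.of_forall hle)
    (hf.integrable_mul_exp (‖z‖ + 2)) (Eventually.of_forall fun ξ w _ => ?_)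
  have h3 := ((((pairing ξ).hasFDerivAt (x := w)).const_mul Complex.I).cexp).const_mul (f ξ)
  refine h3.congr_fderiv ?_
  rw [smul_smul, smul_smul, mul_assoc]

theorem HasExpDecay.differentiable_laplace {f : RSp n → ℂ} (hf : HasExpDecay f) :
    Differentiable ℂ (laplace f) := fun z => (hf.hasFDerivAt_laplace z).2.differentiableAt

theorem HasExpDecay.hasDerivAt_laplace_line {f : RSp n → ℂ} (hf : HasExpDecay f) (z : CSp n)
    (j : Fin n) (w : ℂ) :
    HasDerivAt (fun w : ℂ => laplace f (z + w • EuclideanSpace.single j 1))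
      (laplace (fun ξ => Complex.I * (ξ j : ℂ) * f ξ) (z + w • EuclideanSpace.single j 1)) w := by
  obtain ⟨h1, h2⟩ := hf.hasFDerivAt_laplace (z + w • EuclideanSpace.single j 1)
  have h3 : HasDerivAt (fun w : ℂ => z + w • (EuclideanSpace.single j 1 : CSp n))
      (EuclideanSpace.single j 1) w := by
    simpa using ((hasDerivAt_id w).smul_const (EuclideanSpace.single j 1 : CSp n)).const_add z
  refine (h2.comp_hasDerivAt w h3).congr_deriv ?_
  rw [ContinuousLinearMap.integral_apply h1]
  refine integral_congr_ae (Eventually.of_forall fun ξ => ?_)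
  have h4 : pairing ξ (EuclideanSpace.single j 1) = (ξ j : ℂ) := by
    rw [pairing_apply, Finset.sum_eq_single j] <;> simp +contextual
  simp only [smul_apply, h4, smul_eq_mul]
  ring

/-- Integration by parts: `z_j ∫ f e^{i⟨z, ξ⟩} = i ∫ ∂_j f e^{i⟨z, ξ⟩}`. -/
theorem coord_mul_laplace {f : RSp n → ℂ} (hf : HasExpDecay f) (hf1 : Differentiable ℝ f)
    (j : Fin n) (hf' : HasExpDecay (partialDeriv j f)) (z : CSp n) :
    z j * laplace f z = Complex.I * laplace (partialDeriv j f) z := by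
  have hder : ∀ ξ : RSp n, HasFDerivAt (fun ξ : RSp n => Complex.exp (Complex.I * pairing ξ z))
      (Complex.exp (Complex.I * pairing ξ z) • (Complex.I •
        ∑ i, (z i) • (Complex.ofRealCLM.comp (EuclideanSpace.proj (𝕜 := ℝ) i)))) ξ := by
    intro ξ
    have h1 : HasFDerivAt (fun ξ : RSp n => pairing ξ z)
        (∑ i, (z i) • (Complex.ofRealCLM.comp (EuclideanSpace.proj (𝕜 := ℝ) i))) ξ := by
      have h2 : (fun ξ : RSp n => pairing ξ z) =
          (∑ i, (z i) • (Complex.ofRealCLM.comp (EuclideanSpace.proj (𝕜 := ℝ) i)) :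
            RSp n →L[ℝ] ℂ) := by
        funext ξ
        simp [pairing_apply]
      rw [h2]
      exact ContinuousLinearMap.hasFDerivAt _
    exact (h1.const_mul Complex.I).cexp
  have hval : ∀ ξ : RSp n, fderiv ℝ (fun ξ : RSp n => Complex.exp (Complex.I * pairing ξ z)) ξ
      (EuclideanSpace.single j 1) = Complex.I * z j * Complex.exp (Complex.I * pairing ξ z) := by
    intro ξ
    rw [(hder ξ).fderiv]
    have : (∑ i, z i * (((EuclideanSpace.single j (1 : ℝ) : RSp n) i : ℝ) : ℂ)) = z j := by
      rw [Finset.sum_eq_single j] <;> simp +contextual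
    simp only [smul_apply, sum_apply,
      ContinuousLinearMap.comp_apply, PiLp.proj_apply, Complex.ofRealCLM_apply,
      smul_eq_mul, this]
    ring
  have h := integral_mul_fderiv_eq_neg_fderiv_mul_of_integrable (μ := volume) (f := f)
    (g := fun ξ : RSp n => Complex.exp (Complex.I * pairing ξ z))
    (v := EuclideanSpace.single j (1 : ℝ)) (hf'.integrable_laplace z)
    (by
      refine ((hf.integrable_laplace z).const_mul (Complex.I * z j)).congr
        (Eventually.of_forall fun ξ => ?_)
      simp only [hval]; ring)
    (hf.integrable_laplace z) (fun ξ _ => hf1 ξ) (fun ξ _ => (hder ξ).differentiableAt)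
  have h5 : ∫ ξ, f ξ * fderiv ℝ (fun ξ : RSp n => Complex.exp (Complex.I * pairing ξ z)) ξ
      (EuclideanSpace.single j 1) = Complex.I * z j * laplace f z := by
    rw [laplace, ← integral_const_mul]
    refine integral_congr_ae (Eventually.of_forall fun ξ => ?_)
    simp only [hval]; ring
  rw [h5] at h
  have h6 : Complex.I * z j * laplace f z = -laplace (partialDeriv j f) z := h
  calc z j * laplace f z = -Complex.I * (Complex.I * z j * laplace f z) := by
        linear_combination ((z j * laplace f z)) * Complex.I_mul_I
    _ = _ := by rw [h6]; ring

/-! ### Derivatives and inversion of the Fourier transform -/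

/-- The bilinear form `-⟨x, y⟩ / 2π`, which turns Mathlib's character `e^{-2πi L(x, y)}` into
`e^{i⟨x, y⟩}`. -/
noncomputable def fourierForm (n : ℕ) : RSp n →L[ℝ] RSp n →L[ℝ] ℝ :=
  (-(1 / (2 * Real.pi))) • innerSL ℝ

theorem fourierForm_apply (v w : RSp n) :
    fourierForm n v w = -(1 / (2 * Real.pi)) * inner ℝ v w := rfl

theorem pairing_complexify (ξ x : RSp n) : pairing ξ (complexify x) = ((inner ℝ ξ x : ℝ) : ℂ) := by
  rw [pairing_apply, PiLp.inner_apply]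
  simp [mul_comm]

theorem fourierChar_fourierForm (v w : RSp n) :
    ((Real.fourierChar (-fourierForm n v w) : Circle) : ℂ) =
      Complex.exp (Complex.I * pairing v (complexify w)) := by
  rw [Real.fourierChar_apply, fourierForm_apply, pairing_complexify]
  congr 1
  have : (2 * Real.pi * -(-(1 / (2 * Real.pi)) * inner ℝ v w) : ℝ) = inner ℝ v w := by
    field_simp [Real.pi_ne_zero]
  rw [this, mul_comm]

theorem laplace_complexify_eq (f : RSp n → ℂ) :
    (fun x => laplace f (complexify x)) = VectorFourier.fourierIntegral Real.fourierChar volume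
      (fourierForm n).toLinearMap₁₂ f := by
  funext x
  rw [laplace, VectorFourier.fourierIntegral]
  refine integral_congr_ae (Eventually.of_forall fun ξ => ?_)
  simp only [Circle.smul_def, smul_eq_mul]
  rw [mul_comm]
  congr 1
  exact (fourierChar_fourierForm ξ x).symm

theorem contDiff_laplace_complexify {f : RSp n → ℂ}
    (hf : ∀ k : ℕ, Integrable fun ξ => ‖ξ‖ ^ k * ‖f ξ‖) :
    ContDiff ℝ ((⊤ : ℕ∞) : WithTop ℕ∞) fun x => laplace f (complexify x) := by
  rw [laplace_complexify_eq]
  exact VectorFourier.contDiff_fourierIntegral (fourierForm n) fun k _ => hf k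

theorem partialDeriv_laplace_complexify {f : RSp n → ℂ} (h0 : Integrable f)
    (h1 : Integrable fun ξ => ‖ξ‖ * ‖f ξ‖) (j : Fin n) :
    partialDeriv j (fun x => laplace f (complexify x)) =
      fun x => laplace (fun ξ => Complex.I * (ξ j : ℂ) * f ξ) (complexify x) := by
  funext x
  have hd := VectorFourier.hasFDerivAt_fourierIntegral (fourierForm n) h0 h1 x
  have hi : Integrable (VectorFourier.fourierSMulRight (fourierForm n) f) := by
    refine (h1.const_mul (2 * Real.pi * ‖fourierForm n‖)).mono'
      h0.1.fourierSMulRight (Eventually.of_forall fun v => ?_)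
    exact (VectorFourier.norm_fourierSMulRight_le (fourierForm n) f v).trans_eq (by ring)
  have hi' := (VectorFourier.fourierIntegral_convergent_iff Real.continuous_fourierChar
    (L := (fourierForm n).toLinearMap₁₂) (fourierForm n).continuous₂ (μ := volume) x).2 hi
  rw [partialDeriv, laplace_complexify_eq, hd.fderiv, VectorFourier.fourierIntegral,
    ContinuousLinearMap.integral_apply hi', laplace]
  refine integral_congr_ae (Eventually.of_forall fun ξ => ?_)
  have e1 : fourierForm n ξ (EuclideanSpace.single j 1) = -(1 / (2 * Real.pi)) * ξ j := by
    rw [fourierForm_apply]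
    simp [EuclideanSpace.inner_single_right]
  have e2 : ((Real.fourierChar (-(fourierForm n).toLinearMap₁₂ ξ x) : Circle) : ℂ) =
      Complex.exp (Complex.I * pairing ξ (complexify x)) := fourierChar_fourierForm ξ x
  simp only [smul_apply, Circle.smul_def, VectorFourier.fourierSMulRight_apply, e1, e2]
  rw [Complex.real_smul]
  push_cast
  have hpi : (Real.pi : ℂ) ≠ 0 := by exact_mod_cast Real.pi_ne_zero
  simp only [smul_eq_mul]
  field_simp

/-- The monomial `∏_{j ∈ S} (i ξ_j)^{α_j}` times `f`. -/
noncomputable def monomialMul (α : Fin n → ℕ) (S : Finset (Fin n)) (f : RSp n → ℂ) : RSp n → ℂ :=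
  fun ξ => (∏ j ∈ S, (Complex.I * (ξ j : ℂ)) ^ α j) * f ξ

theorem monomialMul_empty (α : Fin n → ℕ) (f : RSp n → ℂ) : monomialMul α ∅ f = f := by
  funext ξ
  simp [monomialMul]

theorem monomialMul_insert (α : Fin n → ℕ) {i : Fin n} {S : Finset (Fin n)} (hi : i ∉ S)
    (f : RSp n → ℂ) : monomialMul α (insert i S) f =
      fun ξ => (Complex.I * (ξ i : ℂ)) ^ α i * monomialMul α S f ξ := by
  funext ξ
  simp only [monomialMul, Finset.prod_insert hi, mul_assoc]

theorem integrable_pow_norm_mul_coord {f : RSp n → ℂ} (hfc : Continuous f)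
    (hf : ∀ k : ℕ, Integrable fun ξ => ‖ξ‖ ^ k * ‖f ξ‖) (j : Fin n) (k : ℕ) :
    Integrable fun ξ => ‖ξ‖ ^ k * ‖Complex.I * (ξ j : ℂ) * f ξ‖ := by
  refine (hf (k + 1)).mono' (by fun_prop) (Eventually.of_forall fun ξ => ?_)
  rw [Real.norm_of_nonneg (by positivity), norm_mul, norm_mul, Complex.norm_I, one_mul,
    Complex.norm_real, pow_succ, mul_assoc]
  have : ‖ξ j‖ ≤ ‖ξ‖ := PiLp.norm_apply_le ξ j
  gcongr

theorem iterate_partialDeriv_laplace_complexify (j : Fin n) (a : ℕ) {f : RSp n → ℂ}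
    (hfc : Continuous f) (hf : ∀ k : ℕ, Integrable fun ξ => ‖ξ‖ ^ k * ‖f ξ‖) :
    (∀ k : ℕ, Integrable fun ξ => ‖ξ‖ ^ k * ‖(Complex.I * (ξ j : ℂ)) ^ a * f ξ‖) ∧
    (partialDeriv j)^[a] (fun x => laplace f (complexify x)) =
      fun x => laplace (fun ξ => (Complex.I * (ξ j : ℂ)) ^ a * f ξ) (complexify x) := by
  induction a generalizing f with
  | zero => simpa using hf
  | succ a ih =>
    obtain ⟨h1, h2⟩ := ih (f := fun ξ => Complex.I * (ξ j : ℂ) * f ξ) (by fun_prop)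
      (integrable_pow_norm_mul_coord hfc hf j)
    have e : (fun ξ : RSp n => (Complex.I * (ξ j : ℂ)) ^ (a + 1) * f ξ) =
        fun ξ => (Complex.I * (ξ j : ℂ)) ^ a * (Complex.I * (ξ j : ℂ) * f ξ) := by
      funext ξ; ring
    have hfi : Integrable f := by
      rw [← integrable_norm_iff hfc.aestronglyMeasurable]
      simpa using hf 0
    refine ⟨fun k => ?_, ?_⟩
    · simpa only [pow_succ, mul_assoc] using h1 k
    · rw [Function.iterate_succ_apply, partialDeriv_laplace_complexify hfi
        (by simpa using hf 1) j, h2, e]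

/-- `D^α` of the transform of `f` on `ℝⁿ` is the transform of `(iξ)^α f`. -/
theorem multiDeriv_laplace_complexify {f : RSp n → ℂ} (hfc : Continuous f)
    (hf : ∀ k : ℕ, Integrable fun ξ => ‖ξ‖ ^ k * ‖f ξ‖) (α : Fin n → ℕ) :
    multiDeriv α (fun x => laplace f (complexify x)) =
      fun x => laplace (monomialMul α Finset.univ f) (complexify x) := by
  have key : ∀ L : List (Fin n),
      (∀ k : ℕ, Integrable fun ξ : RSp n =>
        ‖ξ‖ ^ k * ‖(L.map fun j => (Complex.I * (ξ j : ℂ)) ^ α j).prod * f ξ‖) ∧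
      L.foldr (fun j g => (partialDeriv j)^[α j] g) (fun x => laplace f (complexify x)) =
        fun x => laplace (fun ξ => (L.map fun j => (Complex.I * (ξ j : ℂ)) ^ α j).prod * f ξ)
          (complexify x) := by
    intro L
    induction L with
    | nil => simpa using hf
    | cons j L ih =>
      have hcont : Continuous fun ξ : RSp n =>
          (L.map fun j => (Complex.I * (ξ j : ℂ)) ^ α j).prod * f ξ :=
        (continuous_list_prod L fun j _ => by fun_prop).mul hfc
      obtain ⟨h1, h2⟩ := iterate_partialDeriv_laplace_complexify j (α j) hcont ih.1
      simp only [List.foldr_cons, List.map_cons, List.prod_cons, ih.2, h2]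
      exact ⟨by simpa only [mul_assoc] using h1, by simp only [mul_assoc]⟩
  rw [multiDeriv, (key _).2]
  simp only [← List.ofFn_eq_map, List.prod_ofFn]
  rfl

theorem fourierInv_eq_laplace (f : RSp n → ℂ) (w : RSp n) :
    FourierTransformInv.fourierInv f w = laplace f (complexify ((2 * Real.pi) • w)) := by
  rw [Real.fourierInv_eq', laplace]
  refine integral_congr_ae (Eventually.of_forall fun v => ?_)
  simp only [pairing_complexify, inner_smul_right, smul_eq_mul]
  rw [mul_comm Complex.I, mul_comm (f v)]

/-- Fourier inversion for the unnormalised transform with kernel `e^{i⟨x, ξ⟩}`, applied twice. -/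
theorem laplace_laplace_complexify {f : RSp n → ℂ} (hfc : Continuous f) (hf : Integrable f)
    (hf' : Integrable fun x => laplace f (complexify x)) (ξ : RSp n) :
    laplace (fun x => laplace f (complexify x)) (complexify ξ) =
      ((2 * Real.pi) ^ n : ℝ) * f (-ξ) := by
  have hpi : (2 * Real.pi) ≠ 0 := by positivity
  set g : RSp n → ℂ := FourierTransformInv.fourierInv f with hg
  have hgf : ∀ x, laplace f (complexify x) = g ((2 * Real.pi)⁻¹ • x) := fun x => by
    rw [hg, fourierInv_eq_laplace, smul_inv_smul₀ hpi]
  have hF : Integrable (FourierTransform.fourier f) := by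
    have h1 : FourierTransform.fourier f =
        fun w => laplace f (complexify ((-(2 * Real.pi)) • w)) := by
      funext w
      rw [← neg_neg w, ← Real.fourierInv_eq_fourier_neg, fourierInv_eq_laplace]
      simp
    rw [h1]
    exact (integrable_comp_smul_iff volume (fun x => laplace f (complexify x))
      (neg_ne_zero.2 hpi)).2 hf'
  have h2 : laplace (fun x => g ((2 * Real.pi)⁻¹ • x)) (complexify ξ) =
      ((2 * Real.pi) ^ n : ℝ) * laplace g (complexify ((2 * Real.pi) • ξ)) := by
    have h3 := Measure.integral_comp_smul volume
      (fun u : RSp n => g u * Complex.exp (Complex.I * pairing u (complexify ((2 * Real.pi) • ξ))))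
      (2 * Real.pi)⁻¹
    rw [inv_pow, inv_inv, finrank_euclideanSpace_fin, abs_of_pos (by positivity),
      Complex.real_smul] at h3
    rw [laplace, laplace, ← h3]
    refine integral_congr_ae (Eventually.of_forall fun x => ?_)
    simp only [pairing_complexify, inner_smul_left, inner_smul_right, RCLike.conj_to_real]
    rw [← mul_assoc, mul_inv_cancel₀ hpi, one_mul]
  simp only [hgf]
  rw [h2, ← fourierInv_eq_laplace, Real.fourierInv_eq_fourier_neg, hg,
    hf.fourier_fourierInv_eq hF hfc.continuousAt]

theorem fourierConst_sq : fourierConst n * fourierConst n * ((2 * Real.pi) ^ n : ℝ) = 1 := by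
  have h : ((Real.sqrt (2 * Real.pi) : ℝ) : ℂ) * ((Real.sqrt (2 * Real.pi) : ℝ) : ℂ) =
      ((2 * Real.pi : ℝ) : ℂ) := by
    rw [← Complex.ofReal_mul, Real.mul_self_sqrt (by positivity)]
  have h0 : ((2 * Real.pi : ℝ) : ℂ) ≠ 0 := by
    exact_mod_cast (by positivity : (2 * Real.pi) ≠ 0)
  rw [fourierConst, div_mul_div_comm, one_mul, ← mul_pow, h, Complex.ofReal_pow,
    one_div, inv_mul_cancel₀ (pow_ne_zero _ h0)]

theorem fourierConst_ne_zero : fourierConst n ≠ 0 := fun h => by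
  simpa [h] using fourierConst_sq (n := n)

/-! ### Cauchy estimates and the Taylor series -/

theorem HasExpDecay.monomial {f : RSp n → ℂ} (hf : HasExpDecay f) (α : Fin n → ℕ)
    (S : Finset (Fin n)) : HasExpDecay (monomialMul α S f) := by
  have hpow : ∀ (j : Fin n) (a : ℕ) (g : RSp n → ℂ), HasExpDecay g →
      HasExpDecay fun ξ => (Complex.I * (ξ j : ℂ)) ^ a * g ξ := by
    intro j a g hg
    induction a with
    | zero => simpa using hg
    | succ a ih => simpa only [pow_succ', mul_assoc] using ih.coord_mul Complex.I j
  induction S using Finset.induction_on with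
  | empty => rwa [monomialMul_empty]
  | insert i S hi ih =>
    rw [monomialMul_insert α hi]
    exact hpow i (α i) _ ih

theorem HasExpDecay.iteratedDeriv_laplace_line {f : RSp n → ℂ} (hf : HasExpDecay f) (z : CSp n)
    (j : Fin n) (k : ℕ) :
    iteratedDeriv k (fun w : ℂ => laplace f (z + w • EuclideanSpace.single j 1)) =
      fun w => laplace (fun ξ => (Complex.I * (ξ j : ℂ)) ^ k * f ξ)
        (z + w • EuclideanSpace.single j 1) := by
  induction k generalizing f with
  | zero => simp
  | succ k ih =>
    rw [iteratedDeriv_succ']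
    have h1 : deriv (fun w : ℂ => laplace f (z + w • EuclideanSpace.single j 1)) =
        fun w => laplace (fun ξ => Complex.I * (ξ j : ℂ) * f ξ)
          (z + w • EuclideanSpace.single j 1) :=
      funext fun w => (hf.hasDerivAt_laplace_line z j w).deriv
    rw [h1, ih (hf.coord_mul Complex.I j)]
    simp only [pow_succ, mul_assoc]

/-- Cauchy's estimate on polydiscs for the Fourier–Laplace transform, whose derivative `D^α` is the
transform of `(iξ)^α f`. -/
theorem HasExpDecay.norm_laplace_monomialMul_le {f : RSp n → ℂ} (hf : HasExpDecay f)
    (α : Fin n → ℕ) {R : Fin n → ℝ} (hR : ∀ j, 0 < R j) {B : ℝ} (z : CSp n)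
    (hB : ∀ w : CSp n, (∀ j, ‖w j‖ ≤ R j) → ‖laplace f (z + w)‖ ≤ B) :
    ‖laplace (monomialMul α Finset.univ f) z‖ ≤
      B * (multiFactorial α / ∏ j, R j ^ α j) := by
  have key : ∀ S : Finset (Fin n), ∀ z : CSp n,
      (∀ w : CSp n, (∀ j, ‖w j‖ ≤ if j ∈ S then R j else 0) → ‖laplace f (z + w)‖ ≤ B) →
      ‖laplace (monomialMul α S f) z‖ ≤ B * ∏ j ∈ S, (((α j).factorial : ℝ) / R j ^ α j) := by
    intro S
    induction S using Finset.induction_on with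
    | empty =>
      intro z hz
      simpa [monomialMul_empty] using hz 0 (by simp)
    | insert i S hi ih =>
      intro z hz
      have hS := hf.monomial α S
      have h1 := Complex.norm_iteratedDeriv_le_of_forall_mem_sphere_norm_le (c := 0)
        (C := B * ∏ j ∈ S, (((α j).factorial : ℝ) / R j ^ α j))
        (f := fun w : ℂ => laplace (monomialMul α S f) (z + w • EuclideanSpace.single i 1))
        (α i) (hR i) (Differentiable.diffContOnCl fun w =>
          (hS.hasDerivAt_laplace_line z i w).differentiableAt) (fun w hw => ?_)
      · rw [hS.iteratedDeriv_laplace_line] at h1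
        simp only [zero_smul, add_zero] at h1
        rw [monomialMul_insert α hi, Finset.prod_insert hi]
        refine h1.trans (le_of_eq ?_)
        ring
      · refine ih _ fun w' hw' => ?_
        rw [add_assoc]
        refine hz _ fun j => ?_
        rw [mem_sphere_zero_iff_norm] at hw
        have h2 := hw' j
        rcases eq_or_ne j i with rfl | hji
        · rw [if_neg hi] at h2
          have h3 : w' j = 0 := norm_le_zero_iff.1 h2
          simp [h3, hw]
        · simpa [hji] using h2
  have h := key Finset.univ z (by simpa using hB)
  rwa [Finset.prod_div_distrib] at h

/-- The Taylor expansion of the Fourier–Laplace transform at `0`, obtained by expanding the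
exponential kernel. -/
theorem HasExpDecay.hasSum_laplace {f : RSp n → ℂ} (hf : HasExpDecay f) (z : CSp n) :
    HasSum (fun α : Fin n → ℕ => laplace (monomialMul α Finset.univ f) 0 /
      (multiFactorial α : ℂ) * ∏ j, z j ^ α j) (laplace f z) := by
  have hfc := hf.1
  have hexp : ∀ ξ : RSp n, HasSum (fun α : Fin n → ℕ =>
      ∏ j, (Complex.I * (z j * (ξ j : ℂ))) ^ α j / ((α j).factorial : ℂ))
      (Complex.exp (Complex.I * pairing ξ z)) := by
    intro ξ
    obtain ⟨h1, h2⟩ := hasSum_prod_pi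
      (fun j k => (Complex.I * (z j * (ξ j : ℂ))) ^ k / (k.factorial : ℂ)) fun j =>
        NormedSpace.norm_expSeries_div_summable (𝔸 := ℂ) _
    have h3 : ∏ j, ∑' k : ℕ, (Complex.I * (z j * (ξ j : ℂ))) ^ k / (k.factorial : ℂ) =
        Complex.exp (Complex.I * pairing ξ z) := by
      rw [pairing_apply, Finset.mul_sum, Complex.exp_sum]
      refine Finset.prod_congr rfl fun j _ => ?_
      rw [Complex.exp_eq_exp_ℂ, NormedSpace.exp_eq_tsum_div]
    rw [← h3, ← h2]
    exact h1.of_norm.hasSum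
  have hbd : ∀ ξ : RSp n, HasSum (fun α : Fin n → ℕ =>
      ‖f ξ‖ * ∏ j, (‖z j‖ * ‖ξ j‖) ^ α j / ((α j).factorial : ℝ))
      (‖f ξ‖ * Real.exp (∑ j, ‖z j‖ * ‖ξ j‖)) := by
    intro ξ
    obtain ⟨h1, h2⟩ := hasSum_prod_pi
      (fun j k => (‖z j‖ * ‖ξ j‖) ^ k / (k.factorial : ℝ)) fun j => summable_exp_series _
    simp only [tsum_exp_series] at h2
    rw [Real.exp_sum, ← h2]
    exact h1.of_norm.hasSum.mul_left _
  have h := hasSum_integral_of_dominated_convergence (μ := volume)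
    (F := fun (α : Fin n → ℕ) (ξ : RSp n) =>
      f ξ * ∏ j, (Complex.I * (z j * (ξ j : ℂ))) ^ α j / ((α j).factorial : ℂ))
    (f := fun ξ => f ξ * Complex.exp (Complex.I * pairing ξ z))
    (fun α ξ => ‖f ξ‖ * ∏ j, (‖z j‖ * ‖ξ j‖) ^ α j / ((α j).factorial : ℝ))
    (fun α => Continuous.aestronglyMeasurable (by fun_prop))
    (fun α => Eventually.of_forall fun ξ => le_of_eq ?_)
    (Eventually.of_forall fun ξ => (hbd ξ).summable)
    ?_ (Eventually.of_forall fun ξ => (hexp ξ).mul_left _)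
  · convert! h using 2 with α
    rw [laplace, ← integral_div, ← integral_mul_const]
    refine integral_congr_ae (Eventually.of_forall fun ξ => ?_)
    simp only [monomialMul, map_zero, mul_zero, Complex.exp_zero, mul_one, multiFactorial,
      Finset.prod_div_distrib, mul_pow, Finset.prod_mul_distrib, Complex.ofReal_prod,
      Complex.ofReal_natCast]
    ring
  · simp [norm_prod]
  · simp only [fun ξ => (hbd ξ).tsum_eq]
    refine (hf.integrable_mul_exp (∑ j, ‖z j‖)).mono' (by fun_prop)
      (Eventually.of_forall fun ξ => ?_)
    rw [Real.norm_of_nonneg (by positivity), Finset.sum_mul]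
    have : ∀ j, ‖ξ j‖ ≤ ‖ξ‖ := fun j => PiLp.norm_apply_le ξ j
    gcongr
    exact this _

/-! ### The transform of an element of `G(h_ν)` -/

theorem one_add_norm_pow_le_sum (m : ℕ) (z : CSp n) :
    (1 + ‖z‖) ^ m ≤ (n + 1 : ℝ) ^ m * (1 + ∑ j, ‖z j‖ ^ m) := by
  have h0 := norm_le_sum_norm z
  have hnn : 0 ≤ ∑ j, ‖z j‖ ^ m := Finset.sum_nonneg fun j _ => by positivity
  by_cases h : ∀ j, ‖z j‖ ≤ 1
  · have h1 : ∑ j, ‖z j‖ ≤ n := by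
      simpa using Finset.sum_le_sum fun j (_ : j ∈ Finset.univ) => h j
    calc (1 + ‖z‖) ^ m ≤ (n + 1 : ℝ) ^ m :=
          pow_le_pow_left₀ (by positivity) (by linarith) m
      _ ≤ _ := le_mul_of_one_le_right (by positivity) (by linarith)
  · push Not at h
    obtain ⟨i, hi⟩ := h
    obtain ⟨j, -, hj⟩ := Finset.exists_max_image Finset.univ (fun j => ‖z j‖) ⟨i, Finset.mem_univ i⟩
    have h1 : ∑ k, ‖z k‖ ≤ n * ‖z j‖ := by
      simpa using Finset.sum_le_sum fun k (hk : k ∈ Finset.univ) => hj k hk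
    have h2 : 1 ≤ ‖z j‖ := hi.le.trans (hj i (Finset.mem_univ i))
    have h3 : ‖z j‖ ^ m ≤ ∑ j, ‖z j‖ ^ m :=
      Finset.single_le_sum (f := fun j => ‖z j‖ ^ m) (fun j _ => by positivity)
        (Finset.mem_univ j)
    calc (1 + ‖z‖) ^ m ≤ ((n + 1 : ℝ) * ‖z j‖) ^ m := by gcongr; linarith
      _ = (n + 1 : ℝ) ^ m * ‖z j‖ ^ m := mul_pow _ _ _
      _ ≤ _ := by gcongr; linarith

theorem contDiff_multiDeriv {α : Fin n → ℕ} {m k : ℕ} (hα : ∑ j, α j + k ≤ m) {f : RSp n → ℂ}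
    (hf : ContDiff ℝ (m : WithTop ℕ∞) f) : ContDiff ℝ (k : WithTop ℕ∞) (multiDeriv α f) := by
  have e : ((List.finRange n).map α).sum = ∑ j, α j := by
    rw [← List.ofFn_eq_map, List.sum_ofFn]
  have hf' : ContDiff ℝ ((((List.finRange n).map α).sum + k : ℕ) : WithTop ℕ∞) f :=
    hf.of_le (by rw [e]; exact_mod_cast hα)
  exact (foldr_partialDeriv α 0 (List.finRange n) k hf' hf').1

theorem hasExpDecay_multiDeriv (H : WeightFamily n) {ν m : ℕ} {f : RSp n → ℂ}
    (hf : f ∈ Gm (H.h ν) m) {α : Fin n → ℕ} (hα : ∑ j, α j ≤ m) :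
    HasExpDecay (multiDeriv α f) := by
  obtain ⟨C, hC, h⟩ := norm_multiDeriv_mul_exp_le H ν
  refine ⟨(contDiff_multiDeriv (k := 0) hα hf.1).continuous, fun r =>
    ⟨_, fun ξ => le_trans ?_ (h m f hf α hα (fun _ => r) ξ)⟩⟩
  refine mul_le_mul_of_nonneg_left (Real.exp_le_exp.2 ?_) (norm_nonneg _)
  rw [← Finset.mul_sum]
  calc r * ‖ξ‖ ≤ (1 + |r|) * ‖ξ‖ := by gcongr; linarith [le_abs_self r]
    _ ≤ _ := by gcongr; exact norm_le_sum_norm ξ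

theorem multiDeriv_zero_index (f : RSp n → ℂ) : multiDeriv 0 f = f := by
  unfold multiDeriv
  induction List.finRange n with
  | nil => rfl
  | cons j L ih => rw [List.foldr_cons, ih]; rfl

theorem multiDeriv_single (j : Fin n) (k : ℕ) (f : RSp n → ℂ) :
    multiDeriv (Pi.single j k) f = (partialDeriv j)^[k] f := by
  have key : ∀ L : List (Fin n), L.Nodup →
      L.foldr (fun i g => (partialDeriv i)^[(Pi.single j k : Fin n → ℕ) i] g) f =
        if j ∈ L then (partialDeriv j)^[k] f else f := by
    intro L hL
    induction L with
    | nil => simp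
    | cons i L ih =>
      rw [List.nodup_cons] at hL
      rw [List.foldr_cons, ih hL.2]
      rcases eq_or_ne i j with rfl | hij
      · simp [hL.1]
      · simp [hij, hij.symm]
  rw [multiDeriv, key _ (List.nodup_finRange n), if_pos (List.mem_finRange j)]

theorem hasExpDecay_of_mem (H : WeightFamily n) {ν m : ℕ} {f : RSp n → ℂ}
    (hf : f ∈ Gm (H.h ν) m) : HasExpDecay f := by
  simpa only [multiDeriv_zero_index] using hasExpDecay_multiDeriv H hf (α := 0) (by simp)

theorem pow_coord_mul_laplace (H : WeightFamily n) {ν m : ℕ} {f : RSp n → ℂ}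
    (hf : f ∈ Gm (H.h ν) m) (j : Fin n) (z : CSp n) {k : ℕ} (hk : k ≤ m) :
    z j ^ k * laplace f z = Complex.I ^ k * laplace (multiDeriv (Pi.single j k) f) z := by
  induction k with
  | zero => simp [multiDeriv_zero_index]
  | succ k ih =>
    have e : multiDeriv (Pi.single j (k + 1)) f =
        partialDeriv j (multiDeriv (Pi.single j k) f) := by
      rw [multiDeriv_single, multiDeriv_single, Function.iterate_succ_apply']
    have hd1 := hasExpDecay_multiDeriv H hf (α := Pi.single j k) (by simp; omega)
    have hd2 := hasExpDecay_multiDeriv H hf (α := Pi.single j (k + 1)) (by simpa using hk)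
    have hdiff := (contDiff_multiDeriv (α := Pi.single j k) (k := 1) (by simpa using hk)
      hf.1).differentiable (by norm_num)
    rw [e] at hd2 ⊢
    rw [pow_succ', mul_assoc, ih (by omega), mul_left_comm, coord_mul_laplace hd1 hdiff j hd2]
    ring

/-- With `t_j = |Im z_j|` the exponential estimate for `D^α f` dominates the kernel
`|e^{i⟨z, ξ⟩}| = e^{-⟨Im z, ξ⟩}`, and a factor `e^{-‖ξ‖}` is left for integrability. -/
theorem norm_laplace_multiDeriv_le (H : WeightFamily n) (ν : ℕ) :
    ∃ C : ℝ, 0 < C ∧ ∀ (m : ℕ) (f : RSp n → ℂ), f ∈ Gm (H.h ν) m → ∀ α : Fin n → ℕ,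
      ∑ j, α j ≤ m → ∀ z : CSp n, ‖laplace (multiDeriv α f) z‖ ≤
        C * gNorm (H.h ν) m f * Real.exp (phi H (ν + 1) fun j => (z j).im) := by
  obtain ⟨C, hC, h⟩ := norm_multiDeriv_mul_exp_le H ν
  have hI : 0 ≤ ∫ ξ : RSp n, Real.exp (-‖ξ‖) := integral_nonneg fun ξ => (Real.exp_pos _).le
  refine ⟨C * ((∫ ξ : RSp n, Real.exp (-‖ξ‖)) + 1), by positivity, fun m f hf α hα z => ?_⟩
  set X := C * gNorm (H.h ν) m f * Real.exp (phi H (ν + 1) fun j => (z j).im) with hX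
  have hX0 : 0 ≤ X := mul_nonneg (mul_nonneg hC.le (gNorm_nonneg _ _ _)) (Real.exp_pos _).le
  have h1 : ‖laplace (multiDeriv α f) z‖ ≤ ∫ ξ : RSp n, X * Real.exp (-‖ξ‖) := by
    refine norm_integral_le_of_norm_le (integrable_exp_neg_norm.const_mul X)
      (Eventually.of_forall fun ξ => ?_)
    rw [norm_mul, norm_exp_pairing, Real.exp_neg ‖ξ‖, ← div_eq_mul_inv,
      le_div_iff₀ (Real.exp_pos _), mul_assoc, ← Real.exp_add]
    refine le_trans ?_ (h m f hf α hα (fun j => (z j).im) ξ)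
    refine mul_le_mul_of_nonneg_left (Real.exp_le_exp.2 ?_) (norm_nonneg _)
    have h2 : ∀ j, -((z j).im * ξ j) ≤ |(z j).im| * |ξ j| := fun j => by
      rw [← abs_mul]; exact neg_le_abs _
    have h3 := Finset.sum_le_sum fun j (_ : j ∈ Finset.univ) => h2 j
    rw [Finset.sum_neg_distrib] at h3
    simp only [add_mul, one_mul, Finset.sum_add_distrib]
    have h4 := norm_le_sum_norm ξ
    simp only [Real.norm_eq_abs] at h4
    linarith
  rw [integral_const_mul] at h1
  have h4 : C * ((∫ ξ : RSp n, Real.exp (-‖ξ‖)) + 1) * gNorm (H.h ν) m f *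
      Real.exp (phi H (ν + 1) fun j => (z j).im) =
      X * (∫ ξ : RSp n, Real.exp (-‖ξ‖)) + X := by rw [hX]; ring
  rw [h4]
  linarith

theorem eTerm_laplace_le (H : WeightFamily n) (ν m : ℕ) :
    ∃ C : ℝ, 0 < C ∧ ∀ f : RSp n → ℂ, f ∈ Gm (H.h ν) m → ∀ z : CSp n,
      eTerm (phi H (ν + 1)) m (laplace f) z ≤ C * gNorm (H.h ν) m f := by
  obtain ⟨C, hC, h⟩ := norm_laplace_multiDeriv_le H ν
  refine ⟨(n + 1 : ℝ) ^ m * (n + 1) * C, by positivity, fun f hf z => ?_⟩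
  set X := C * gNorm (H.h ν) m f * Real.exp (phi H (ν + 1) fun j => (z j).im) with hX
  have h0 : ‖laplace f z‖ ≤ X := by
    simpa only [multiDeriv_zero_index] using h m f hf 0 (by simp) z
  have h1 : ∀ j, ‖z j‖ ^ m * ‖laplace f z‖ ≤ X := fun j => by
    rw [← norm_pow, ← norm_mul, pow_coord_mul_laplace H hf j z le_rfl, norm_mul, norm_pow,
      Complex.norm_I, one_pow, one_mul]
    exact h m f hf _ (by simp) z
  rw [eTerm, div_le_iff₀ (Real.exp_pos _)]
  have h2 : ∑ j, ‖z j‖ ^ m * ‖laplace f z‖ ≤ n * X := by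
    simpa using Finset.sum_le_sum fun j (_ : j ∈ Finset.univ) => h1 j
  calc ‖laplace f z‖ * (1 + ‖z‖) ^ m
      ≤ ‖laplace f z‖ * ((n + 1 : ℝ) ^ m * (1 + ∑ j, ‖z j‖ ^ m)) :=
        mul_le_mul_of_nonneg_left (one_add_norm_pow_le_sum m z) (norm_nonneg _)
    _ = (n + 1 : ℝ) ^ m * (‖laplace f z‖ + ∑ j, ‖z j‖ ^ m * ‖laplace f z‖) := by
        rw [← Finset.sum_mul]; ring
    _ ≤ (n + 1 : ℝ) ^ m * (X + n * X) := by gcongr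
    _ = _ := by rw [hX]; ring

theorem laplace_mem_Em (H : WeightFamily n) {ν m : ℕ} {f : RSp n → ℂ} (hf : f ∈ Gm (H.h ν) m) :
    laplace f ∈ Em (phi H (ν + 1)) m := by
  obtain ⟨C, -, h⟩ := eTerm_laplace_le H ν m
  exact ⟨(hasExpDecay_of_mem H hf).differentiable_laplace,
    C * gNorm (H.h ν) m f, by rintro _ ⟨z, rfl⟩; exact h f hf z⟩

theorem one_add_norm_le_mul_prod (z w : CSp n) :
    1 + ‖z‖ ≤ (1 + ‖z + w‖) * ∏ j, (1 + ‖w j‖) := by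
  have h1 : ‖z‖ ≤ ‖z + w‖ + ‖w‖ := by
    simpa using norm_sub_le (z + w) w
  calc 1 + ‖z‖ ≤ (1 + ‖z + w‖) * (1 + ‖w‖) := by
        nlinarith [norm_nonneg (z + w), norm_nonneg w]
    _ ≤ _ := mul_le_mul_of_nonneg_left (one_add_norm_le_prod w) (by positivity)

theorem contDiff_fourierT {f : RSp n → ℂ}
    (hf : ∀ k : ℕ, Integrable fun ξ => ‖ξ‖ ^ k * ‖f ξ‖) :
    ContDiff ℝ ((⊤ : ℕ∞) : WithTop ℕ∞) (fourierT f) := by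
  rw [funext (fourierT_eq f)]
  exact contDiff_const.mul (contDiff_laplace_complexify hf)

theorem multiDeriv_fourierT {f : RSp n → ℂ} (hfc : Continuous f)
    (hf : ∀ k : ℕ, Integrable fun ξ => ‖ξ‖ ^ k * ‖f ξ‖) (α : Fin n → ℕ) (x : RSp n) :
    multiDeriv α (fourierT f) x =
      fourierConst n * laplace (monomialMul α Finset.univ f) (complexify x) := by
  have hsm := contDiff_laplace_complexify hf
  have heq : fourierT f = fourierConst n • (fun x => laplace f (complexify x)) :=
    funext fun x => fourierT_eq f x
  have h1 := multiDeriv_lin (le_refl (∑ j, α j)) (fourierConst n)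
    (f := fun x => laplace f (complexify x)) (g := 0)
    (hsm.of_le (by exact_mod_cast le_top)) contDiff_zero_fun
  rw [add_zero, multiDeriv_zero, add_zero, ← heq,
    multiDeriv_laplace_complexify hfc hf] at h1
  rw [h1]
  rfl

/-- Derivatives of `𝓕 f` are estimated by Cauchy's inequalities on polydiscs with radii `e^{s_j}`.
The factor `∏ (1 + e^{s_j})^m` lost when comparing `1 + ‖x‖` on the polydisc with its value at the
centre is absorbed by one step in the family of weights. -/
theorem fourierT_mem_calE (H : WeightFamily n) {ν : ℕ} {f : RSp n → ℂ} (hf : f ∈ Gstep (H.h ν)) :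
    fourierT f ∈ calE H := by
  have hfm : ∀ m, f ∈ Gm (H.h ν) m := fun m => (Submodule.mem_iInf _).1 hf m
  have hd := hasExpDecay_of_mem H (hfm 0)
  refine ⟨ν + 3, fun m => ⟨?_, ?_⟩⟩
  · exact contDiff_fourierT hd.integrable_pow_norm_mul
  obtain ⟨C₁, hC₁⟩ := phi_add_log_le H (ν + 1) m
  obtain ⟨C₂, hC₂⟩ := exists_phi_sub_le H (ν + 2)
  set E := eNorm (phi H (ν + 1)) m (laplace f) with hE
  have hE0 : 0 ≤ E := eNorm_nonneg _ _ _
  refine ⟨‖fourierConst n‖ * (E * Real.exp (C₁ + C₂)), ?_⟩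
  rintro _ ⟨⟨x, α⟩, rfl⟩
  simp only
  obtain ⟨s, hs⟩ := hC₂ (fun j => (α j : ℝ)) fun j => Nat.cast_nonneg _
  have hcau := hd.norm_laplace_monomialMul_le α (fun j => Real.exp_pos (s j)) (complexify x)
    (B := E * Real.exp (C₁ + phi H (ν + 2) fun j => Real.exp (s j)) / (1 + ‖x‖) ^ m)
    (fun w hw => by
      have h1 := eTerm_le_eNorm (laplace_mem_Em H (hfm m)) (complexify x + w)
      rw [← hE, eTerm, div_le_iff₀ (Real.exp_pos _)] at h1
      have h2 := one_add_norm_le_mul_prod (complexify x) w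
      rw [norm_complexify] at h2
      have h3 : ∏ j, (1 + ‖w j‖) ≤ ∏ j, (1 + Real.exp (s j)) :=
        Finset.prod_le_prod (fun j _ => by positivity) fun j _ => by linarith [hw j]
      have h4 : (1 + ‖x‖) ^ m ≤
          (1 + ‖complexify x + w‖) ^ m * (∏ j, (1 + Real.exp (s j))) ^ m := by
        rw [← mul_pow]
        refine pow_le_pow_left₀ (by positivity) (h2.trans ?_) m
        exact mul_le_mul_of_nonneg_left h3 (by positivity)
      have h5 : (∏ j, (1 + Real.exp (s j))) ^ m =
          Real.exp (m * ∑ j, Real.log (1 + |Real.exp (s j)|)) := by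
        rw [Real.exp_nat_mul, Real.exp_sum]
        congr 1
        refine Finset.prod_congr rfl fun j _ => ?_
        rw [abs_of_pos (Real.exp_pos _), Real.exp_log (by positivity)]
      have h6 : phi H (ν + 1) (fun j => ((complexify x + w) j).im) ≤
          phi H (ν + 1) fun j => Real.exp (s j) := by
        refine phi_mono H _ fun j => ?_
        rw [abs_of_pos (Real.exp_pos _)]
        simpa using (Complex.abs_im_le_norm (w j)).trans (hw j)
      rw [le_div_iff₀ (by positivity)]
      calc ‖laplace f (complexify x + w)‖ * (1 + ‖x‖) ^ m
          ≤ ‖laplace f (complexify x + w)‖ * ((1 + ‖complexify x + w‖) ^ m *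
            (∏ j, (1 + Real.exp (s j))) ^ m) := mul_le_mul_of_nonneg_left h4 (norm_nonneg _)
        _ = ‖laplace f (complexify x + w)‖ * (1 + ‖complexify x + w‖) ^ m *
            (∏ j, (1 + Real.exp (s j))) ^ m := by ring
        _ ≤ E * Real.exp (phi H (ν + 1) fun j => ((complexify x + w) j).im) *
            (∏ j, (1 + Real.exp (s j))) ^ m := by gcongr
        _ ≤ E * Real.exp (C₁ + phi H (ν + 2) fun j => Real.exp (s j)) := by
            rw [h5, mul_assoc, ← Real.exp_add]
            refine mul_le_mul_of_nonneg_left (Real.exp_le_exp.2 ?_) hE0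
            have := hC₁ fun j => Real.exp (s j)
            linarith)
  have hder : ‖multiDeriv α (fourierT f) x‖ =
      ‖fourierConst n‖ * ‖laplace (monomialMul α Finset.univ f) (complexify x)‖ := by
    rw [multiDeriv_fourierT hd.1 hd.integrable_pow_norm_mul, norm_mul]
  have hprod : (∏ j, Real.exp (s j) ^ α j) = Real.exp (∑ j, s j * α j) := by
    rw [Real.exp_sum]
    exact Finset.prod_congr rfl fun j _ => by rw [mul_comm, Real.exp_nat_mul]
  have hfac : 0 < multiFactorial α :=
    Finset.prod_pos fun j _ => by exact_mod_cast (α j).factorial_pos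
  rw [hprod, div_mul_eq_mul_div, le_div_iff₀ (by positivity)] at hcau
  rw [hder, div_le_iff₀ (indexWeight_pos _ _), indexWeight]
  have hexp : Real.exp (C₁ + phi H (ν + 2) fun j => Real.exp (s j)) /
      Real.exp (∑ j, s j * (α j : ℝ)) ≤
      Real.exp (C₁ + C₂) * Real.exp (-atIndex (H.h (ν + 3)) α) := by
    rw [← Real.exp_sub, ← Real.exp_add, Real.exp_le_exp, atIndex]
    linarith
  calc (1 + ‖x‖) ^ m * (‖fourierConst n‖ *
        ‖laplace (monomialMul α Finset.univ f) (complexify x)‖)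
      = ‖fourierConst n‖ * (‖laplace (monomialMul α Finset.univ f) (complexify x)‖ *
        (1 + ‖x‖) ^ m) := by ring
    _ ≤ ‖fourierConst n‖ * (E * Real.exp (C₁ + phi H (ν + 2) fun j => Real.exp (s j)) *
        (multiFactorial α / Real.exp (∑ j, s j * (α j : ℝ)))) :=
        mul_le_mul_of_nonneg_left hcau (norm_nonneg _)
    _ = ‖fourierConst n‖ * E * multiFactorial α *
        (Real.exp (C₁ + phi H (ν + 2) fun j => Real.exp (s j)) /
          Real.exp (∑ j, s j * (α j : ℝ))) := by ring
    _ ≤ ‖fourierConst n‖ * E * multiFactorial α *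
        (Real.exp (C₁ + C₂) * Real.exp (-atIndex (H.h (ν + 3)) α)) := by gcongr
    _ = _ := by ring

theorem hasSum_taylorTerm_fourierT (H : WeightFamily n) {ν : ℕ} {f : RSp n → ℂ}
    (hf : f ∈ Gstep (H.h ν)) (z : CSp n) :
    HasSum (taylorTerm (fourierT f) z) (fourierConst n * laplace f z) := by
  have hd := hasExpDecay_of_mem H ((Submodule.mem_iInf _).1 hf 0)
  convert! (hd.hasSum_laplace z).mul_left (fourierConst n) using 2 with α
  have h2 : complexify (0 : RSp n) = 0 := by ext j; simp
  rw [taylorTerm, multiDeriv_fourierT hd.1 hd.integrable_pow_norm_mul, h2]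
  ring

/-! ### Shifting the domain of integration -/

/-- The integral of a decaying entire function over `ℝⁿ + iη` does not depend on `η`:
`w ↦ ∫ G(x + wη) dx` is entire, and it is invariant under real translations of `w`, hence
constant. -/
theorem integral_complexify_add_I_smul {G : CSp n → ℂ} (hG : Differentiable ℂ G)
    (hb : ∀ r : ℝ, ∃ A : ℝ, ∀ z : CSp n, (∀ j, |(z j).im| ≤ r) → ‖G z‖ * (1 + ‖z‖) ^ (n + 1) ≤ A)
    (η : RSp n) :
    ∫ x : RSp n, G (complexify x + Complex.I • complexify η) = ∫ x : RSp n, G (complexify x) := by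
  have hdom : ∀ r : ℝ, ∃ B : ℝ, ∀ w : ℂ, ‖w‖ ≤ r → ∀ x : RSp n,
      ‖G (complexify x + w • complexify η)‖ ≤ B * ((1 + ‖x‖) ^ (n + 1))⁻¹ := by
    intro r
    obtain ⟨A, hA⟩ := hb (r * ‖η‖)
    refine ⟨A * (1 + r * ‖η‖) ^ (n + 1), fun w hw x => ?_⟩
    have hr : 0 ≤ r := (norm_nonneg w).trans hw
    have h1 := hA (complexify x + w • complexify η) fun j => by
      have h2 : ((complexify x + w • complexify η) j).im = w.im * η j := by simp
      have h3 : |η j| ≤ ‖η‖ := PiLp.norm_apply_le η j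
      rw [h2, abs_mul]
      exact mul_le_mul ((Complex.abs_im_le_norm w).trans hw) h3 (abs_nonneg _) hr
    have h2 : 1 + ‖x‖ ≤ (1 + ‖complexify x + w • complexify η‖) * (1 + r * ‖η‖) := by
      have h3 := norm_sub_le (complexify x + w • complexify η) (w • complexify η)
      rw [add_sub_cancel_right, norm_complexify, norm_smul, norm_complexify] at h3
      have h4 : ‖w‖ * ‖η‖ ≤ r * ‖η‖ := by gcongr
      nlinarith [norm_nonneg (complexify x + w • complexify η), norm_nonneg η,
        mul_nonneg hr (norm_nonneg η)]
    rw [← div_eq_mul_inv, le_div_iff₀ (by positivity)]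
    calc ‖G (complexify x + w • complexify η)‖ * (1 + ‖x‖) ^ (n + 1)
        ≤ ‖G (complexify x + w • complexify η)‖ *
          ((1 + ‖complexify x + w • complexify η‖) * (1 + r * ‖η‖)) ^ (n + 1) := by gcongr
      _ = ‖G (complexify x + w • complexify η)‖ *
          (1 + ‖complexify x + w • complexify η‖) ^ (n + 1) * (1 + r * ‖η‖) ^ (n + 1) := by
        rw [mul_pow]; ring
      _ ≤ _ := by gcongr
  have hline : ∀ x : RSp n, Differentiable ℂ fun w : ℂ => G (complexify x + w • complexify η) :=
    fun x => hG.comp ((differentiable_id.smul_const _).const_add _)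
  have hcont : Continuous (Function.uncurry fun (x : RSp n) (w : ℂ) =>
      G (complexify x + w • complexify η)) := by
    have h1 := continuous_complexify (n := n)
    have h2 := hG.continuous
    unfold Function.uncurry
    fun_prop
  have hmeas : ∀ w : ℂ, AEStronglyMeasurable
      (fun x : RSp n => G (complexify x + w • complexify η)) volume := fun w =>
    (hcont.comp (Continuous.prodMk_left w)).aestronglyMeasurable
  set J : ℂ → ℂ := fun w => ∫ x : RSp n, G (complexify x + w • complexify η) with hJ
  have hJd : Differentiable ℂ J := by
    intro w₀
    obtain ⟨B, hB⟩ := hdom (‖w₀‖ + 2)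
    have hint := (integrable_one_add_norm_pow_inv (n := n)).const_mul B
    refine (hasDerivAt_integral_of_dominated_loc_of_deriv_le
      (F := fun w x => G (complexify x + w • complexify η))
      (F' := fun w x => deriv (fun w : ℂ => G (complexify x + w • complexify η)) w)
      (Metric.ball_mem_nhds w₀ one_pos) (Eventually.of_forall hmeas)
      (hint.mono' (hmeas w₀) (Eventually.of_forall (hB w₀ (by linarith))))
      ?_ (Eventually.of_forall fun x w hw => ?_) hint
      (Eventually.of_forall fun x w _ => (hline x w).hasDerivAt)).2.differentiableAt
    · exact ((measurable_deriv_with_param hcont).comp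
        (measurable_id.prodMk measurable_const)).aestronglyMeasurable
    · refine (Complex.norm_deriv_le_of_forall_mem_sphere_norm_le one_pos
        (hline x).diffContOnCl fun u hu => hB u ?_ x).trans_eq (div_one _)
      have h1 := norm_sub_norm_le u w
      have h2 := norm_sub_norm_le w w₀
      rw [mem_sphere_iff_norm] at hu
      rw [mem_ball_iff_norm] at hw
      linarith
  have hJr : ∀ (w : ℂ) (r : ℝ), J (w + r) = J w := by
    intro w r
    have h1 := integral_add_right_eq_self (μ := volume)
      (fun x : RSp n => G (complexify x + w • complexify η)) (r • η)
    simp only [hJ]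
    rw [← h1]
    refine integral_congr_ae (Eventually.of_forall fun x => ?_)
    simp only
    congr 1
    ext j
    simp
    ring
  have hJ0 : ∀ w, deriv J w = 0 := by
    intro w
    have h1 : HasDerivAt (fun r : ℂ => J (w + r)) (deriv J w) ((0 : ℝ) : ℂ) :=
      HasDerivAt.comp_const_add w _ (by simpa using (hJd w).hasDerivAt)
    have h2 := h1.comp_ofReal
    simp only [hJr] at h2
    exact h2.unique (hasDerivAt_const _ _)
  have h := is_const_of_deriv_eq_zero hJd hJ0 Complex.I 0
  simpa [hJ] using h

/-! ### The inverse transform of an element of `E(φ_ν)` -/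

theorem norm_mul_pow_le_of_mem_Em {φ : (Fin n → ℝ) → ℝ} {m : ℕ} {F : CSp n → ℂ}
    (hF : F ∈ Em φ m) (z : CSp n) :
    ‖F z‖ * (1 + ‖z‖) ^ m ≤ eNorm φ m F * Real.exp (φ fun j => (z j).im) := by
  have h := eTerm_le_eNorm hF z
  rwa [eTerm, div_le_iff₀ (Real.exp_pos _)] at h

theorem norm_le_norm_complexify_add (x η : RSp n) :
    ‖x‖ ≤ ‖complexify x + Complex.I • complexify η‖ := by
  rw [EuclideanSpace.norm_eq, EuclideanSpace.norm_eq]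
  refine Real.sqrt_le_sqrt (Finset.sum_le_sum fun j _ => ?_)
  have h := Complex.abs_re_le_norm ((complexify x + Complex.I • complexify η) j)
  have h1 : ((complexify x + Complex.I • complexify η) j).re = x j := by simp
  rw [h1] at h
  rw [Real.norm_eq_abs]
  gcongr

theorem integrable_pow_norm_mul_complexify {φ : (Fin n → ℝ) → ℝ} {F : CSp n → ℂ}
    (hF : F ∈ Estep φ) (k : ℕ) :
    Integrable fun x : RSp n => ‖x‖ ^ k * ‖F (complexify x)‖ := by
  have hFm := (Submodule.mem_iInf _).1 hF (k + (n + 1))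
  have h1 := hFm.1.continuous
  have h2 := continuous_complexify (n := n)
  refine (integrable_one_add_norm_pow_inv.const_mul
    (eNorm φ (k + (n + 1)) F * Real.exp (φ 0))).mono' (by fun_prop)
    (Eventually.of_forall fun x => ?_)
  have h := norm_mul_pow_le_of_mem_Em hFm (complexify x)
  have e : (fun j => (complexify x j).im) = 0 := by funext j; simp
  rw [e, norm_complexify, pow_add] at h
  rw [Real.norm_of_nonneg (by positivity), ← div_eq_mul_inv, le_div_iff₀ (by positivity)]
  refine le_trans ?_ h
  have h3 : ‖x‖ ^ k ≤ (1 + ‖x‖) ^ k := by gcongr; linarith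
  calc ‖x‖ ^ k * ‖F (complexify x)‖ * (1 + ‖x‖) ^ (n + 1)
      ≤ (1 + ‖x‖) ^ k * ‖F (complexify x)‖ * (1 + ‖x‖) ^ (n + 1) := by gcongr
    _ = _ := by ring

/-- The estimate obtained by integrating over `ℝⁿ + iη` instead of `ℝⁿ`. -/
theorem norm_laplace_monomialMul_complexify_le (H : WeightFamily n) (ν : ℕ) {m : ℕ}
    {F : CSp n → ℂ} (hF : F ∈ Em (phi H ν) (m + (n + 1))) {α : Fin n → ℕ} (hα : ∑ j, α j ≤ m)
    (ξ η : RSp n) :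
    ‖laplace (monomialMul α Finset.univ fun x => F (complexify x)) (complexify ξ)‖ *
      Real.exp (∑ j, η j * ξ j) ≤
      (∫ x : RSp n, ((1 + ‖x‖) ^ (n + 1))⁻¹) * eNorm (phi H ν) (m + (n + 1)) F *
        Real.exp (phi H ν fun j => η j) := by
  set N := eNorm (phi H ν) (m + (n + 1)) F with hN
  have hN0 : 0 ≤ N := eNorm_nonneg _ _ _
  set G : CSp n → ℂ := fun z =>
    (∏ j, (Complex.I * z j) ^ α j) * F z * Complex.exp (Complex.I * pairing ξ z) with hG
  have hGd : Differentiable ℂ G := by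
    have h1 := hF.1
    have h2 : Differentiable ℂ fun z : CSp n => ∏ j, (Complex.I * z j) ^ α j :=
      fun z => (HasFDerivAt.finsetProd (u := Finset.univ)
        (g := fun (j : Fin n) (z : CSp n) => (Complex.I * z j) ^ α j) fun j _ =>
          DifferentiableAt.hasFDerivAt (by fun_prop)).differentiableAt
    exact (h2.mul h1).mul (((pairing ξ).differentiable.const_mul _).cexp)
  have hGb : ∀ z, ‖G z‖ * (1 + ‖z‖) ^ (n + 1) ≤
      N * Real.exp (phi H ν fun j => (z j).im) * Real.exp (-∑ j, (z j).im * ξ j) := by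
    intro z
    have h1 : ‖∏ j, (Complex.I * z j) ^ α j‖ ≤ (1 + ‖z‖) ^ m := by
      rw [norm_prod]
      calc ∏ j, ‖(Complex.I * z j) ^ α j‖ ≤ ∏ j, (1 + ‖z‖) ^ α j := by
            refine Finset.prod_le_prod (fun j _ => norm_nonneg _) fun j _ => ?_
            rw [norm_pow, norm_mul, Complex.norm_I, one_mul]
            have h2 : ‖z j‖ ≤ ‖z‖ := PiLp.norm_apply_le z j
            gcongr
            linarith
        _ = (1 + ‖z‖) ^ ∑ j, α j := Finset.prod_pow_eq_pow_sum _ _ _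
        _ ≤ _ := pow_le_pow_right₀ (by linarith [norm_nonneg z]) hα
    have h2 := norm_mul_pow_le_of_mem_Em hF z
    simp only [hG, norm_mul, norm_exp_pairing]
    calc _ ≤ (1 + ‖z‖) ^ m * ‖F z‖ * Real.exp (-∑ j, (z j).im * ξ j) * (1 + ‖z‖) ^ (n + 1) := by
          gcongr
      _ = ‖F z‖ * (1 + ‖z‖) ^ (m + (n + 1)) * Real.exp (-∑ j, (z j).im * ξ j) := by
          rw [pow_add]; ring
      _ ≤ _ := mul_le_mul_of_nonneg_right h2 (Real.exp_pos _).le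
  have hshift := integral_complexify_add_I_smul hGd (fun r => by
    refine ⟨N * Real.exp (phi H ν fun _ => r) * Real.exp (∑ j, r * |ξ j|), fun z hz =>
      (hGb z).trans ?_⟩
    have h1 : phi H ν (fun j => (z j).im) ≤ phi H ν fun _ => r :=
      phi_mono H ν fun j => (hz j).trans (le_abs_self r)
    have h2 : -∑ j, (z j).im * ξ j ≤ ∑ j, r * |ξ j| := by
      rw [← Finset.sum_neg_distrib]
      refine Finset.sum_le_sum fun j _ => (neg_le_abs _).trans ?_
      rw [abs_mul]
      exact mul_le_mul_of_nonneg_right (hz j) (abs_nonneg _)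
    gcongr) η
  have hlap : laplace (monomialMul α Finset.univ fun x => F (complexify x)) (complexify ξ) =
      ∫ x : RSp n, G (complexify x) := by
    refine integral_congr_ae (Eventually.of_forall fun x => ?_)
    simp only [hG, monomialMul, pairing_complexify, real_inner_comm, complexify_apply]
  rw [hlap, ← hshift, ← le_div_iff₀ (Real.exp_pos _)]
  have hbound : ‖∫ x : RSp n, G (complexify x + Complex.I • complexify η)‖ ≤
      ∫ x : RSp n, N * Real.exp (phi H ν fun j => η j) * Real.exp (-∑ j, η j * ξ j) *
        ((1 + ‖x‖) ^ (n + 1))⁻¹ := by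
    refine norm_integral_le_of_norm_le (integrable_one_add_norm_pow_inv.const_mul _)
      (Eventually.of_forall fun x => ?_)
    have h1 := hGb (complexify x + Complex.I • complexify η)
    have h2 : ∀ j, ((complexify x + Complex.I • complexify η) j).im = η j := fun j => by simp
    simp only [h2] at h1
    rw [← div_eq_mul_inv, le_div_iff₀ (by positivity)]
    refine le_trans ?_ h1
    have h3 := norm_le_norm_complexify_add x η
    gcongr
  rw [integral_const_mul, Real.exp_neg] at hbound
  refine hbound.trans (le_of_eq ?_)
  rw [div_eq_mul_inv]
  ring

theorem gTerm_fourierT_complexify_le (H : WeightFamily n) (ν m : ℕ) :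
    ∃ C : ℝ, 0 < C ∧ ∀ F : CSp n → ℂ, F ∈ Estep (phi H ν) → ∀ i : GIndex n m,
      gTerm (H.h (ν + 1)) m (fourierT fun x => F (complexify x)) i ≤
        C * eNorm (phi H ν) (m + (n + 1)) F := by
  obtain ⟨C, hC, h⟩ := gTerm_le_of_exp_decay H ν
  have hI : 0 ≤ ∫ x : RSp n, ((1 + ‖x‖) ^ (n + 1))⁻¹ := integral_nonneg fun x => by positivity
  refine ⟨C * (‖fourierConst n‖ * ((∫ x : RSp n, ((1 + ‖x‖) ^ (n + 1))⁻¹) + 1)),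
    mul_pos hC (mul_pos (norm_pos_iff.2 fourierConst_ne_zero) (by positivity)), ?_⟩
  rintro F hF ⟨ξ, β, ⟨α, hα⟩⟩
  have hFm := (Submodule.mem_iInf _).1 hF (m + (n + 1))
  set N := eNorm (phi H ν) (m + (n + 1)) F with hN
  have hN0 : 0 ≤ N := eNorm_nonneg _ _ _
  have key := h ξ ‖multiDeriv α (fourierT fun x => F (complexify x)) ξ‖
    (‖fourierConst n‖ * ((∫ x : RSp n, ((1 + ‖x‖) ^ (n + 1))⁻¹) + 1) * N) (norm_nonneg _)
    (by positivity) (fun s => ?_) β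
  · rw [← mul_assoc] at key
    exact key
  · rw [multiDeriv_fourierT (f := fun x => F (complexify x))
      (hFm.1.continuous.comp continuous_complexify)
      (integrable_pow_norm_mul_complexify hF), norm_mul]
    -- the shift `η` has the signs of `ξ`, so that `⟨η, ξ⟩ = ∑ e^{s_j} |ξ_j|`
    have h1 := norm_laplace_monomialMul_complexify_le H ν hFm hα ξ
      (WithLp.toLp 2 fun j => if 0 ≤ ξ j then Real.exp (s j) else -Real.exp (s j))
    have e1 : ∑ j, (WithLp.toLp 2 fun j => if 0 ≤ ξ j then Real.exp (s j) else -Real.exp (s j) :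
        RSp n) j * ξ j = ∑ j, Real.exp (s j) * |ξ j| := by
      refine Finset.sum_congr rfl fun j _ => ?_
      simp only
      split_ifs with h2
      · rw [abs_of_nonneg h2]
      · rw [abs_of_neg (not_le.1 h2)]; ring
    have e2 : phi H ν (fun j => (WithLp.toLp 2 fun j => if 0 ≤ ξ j then Real.exp (s j) else
        -Real.exp (s j) : RSp n) j) ≤ phi H ν fun j => Real.exp (s j) := by
      refine phi_mono H ν fun j => le_of_eq ?_
      simp only
      split_ifs <;> simp
    rw [e1] at h1
    rw [mul_assoc, mul_assoc, mul_assoc]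
    refine mul_le_mul_of_nonneg_left (h1.trans ?_) (norm_nonneg _)
    rw [mul_assoc]
    gcongr
    linarith

theorem fourierT_complexify_mem_Gstep (H : WeightFamily n) {ν : ℕ} {F : CSp n → ℂ}
    (hF : F ∈ Estep (phi H ν)) : (fourierT fun x => F (complexify x)) ∈ Gstep (H.h (ν + 1)) := by
  refine (Submodule.mem_iInf _).2 fun m => ⟨?_, ?_⟩
  · exact (contDiff_fourierT (integrable_pow_norm_mul_complexify hF)).of_le
      (by exact_mod_cast le_top)
  · obtain ⟨C, -, h⟩ := gTerm_fourierT_complexify_le H ν m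
    exact ⟨_, by rintro _ ⟨i, rfl⟩; exact h F hF i⟩

/-! ### Bijectivity of the transform -/

/-- An entire function on `ℂⁿ` is determined by its values on `ℝⁿ`: restrict to the complex lines
`w ↦ x + w y`. -/
theorem eq_of_eqOn_complexify {F G : CSp n → ℂ} (hF : Differentiable ℂ F)
    (hG : Differentiable ℂ G) (h : ∀ x, F (complexify x) = G (complexify x)) : F = G := by
  funext z
  set x : RSp n := WithLp.toLp 2 fun j => (z j).re with hx
  set y : RSp n := WithLp.toLp 2 fun j => (z j).im with hy
  have hz : z = complexify x + Complex.I • complexify y := by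
    ext j
    simp [hx, hy, mul_comm Complex.I, Complex.re_add_im]
  have hline : ∀ {K : CSp n → ℂ}, Differentiable ℂ K →
      AnalyticOnNhd ℂ (fun w : ℂ => K (complexify x + w • complexify y)) Set.univ :=
    fun {K} hK => (hK.comp ((differentiable_id.smul_const _).const_add _)).differentiableOn
      |>.analyticOnNhd isOpen_univ
  have hreal : ∀ r : ℝ, F (complexify x + (r : ℂ) • complexify y) =
      G (complexify x + (r : ℂ) • complexify y) := fun r => by
    have e : complexify x + (r : ℂ) • complexify y = complexify (x + r • y) := by
      ext j; simp
    rw [e, h]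
  have hfreq : ∃ᶠ w in nhdsWithin (0 : ℂ) {0}ᶜ, F (complexify x + w • complexify y) =
      G (complexify x + w • complexify y) := by
    have ht : Tendsto (fun r : ℝ => (r : ℂ)) (nhdsWithin (0 : ℝ) {0}ᶜ)
        (nhdsWithin (0 : ℂ) {0}ᶜ) := by
      refine tendsto_nhdsWithin_iff.2 ⟨?_, ?_⟩
      · exact (Complex.continuous_ofReal.tendsto' 0 0 (by simp)).mono_left nhdsWithin_le_nhds
      · filter_upwards [self_mem_nhdsWithin] with r hr
        simpa using hr
    exact ht.frequently (Eventually.of_forall hreal).frequently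
  have := AnalyticOnNhd.eqOn_of_preconnected_of_frequently_eq (hline hF) (hline hG)
    isPreconnected_univ (Set.mem_univ 0) hfreq (Set.mem_univ Complex.I)
  rw [hz]
  exact this

theorem laplace_const_mul (c : ℂ) (f : RSp n → ℂ) (z : CSp n) :
    laplace (fun ξ => c * f ξ) z = c * laplace f z := by
  rw [laplace, laplace, ← integral_const_mul]
  simp only [mul_assoc]

theorem fourierT_fourierT {f : RSp n → ℂ} (hfc : Continuous f) (hf : Integrable f)
    (hf' : Integrable (fourierT f)) (x : RSp n) : fourierT (fourierT f) x = f (-x) := by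
  have h1 : Integrable fun x => laplace f (complexify x) := by
    rw [funext (fourierT_eq f)] at hf'
    exact (integrable_const_mul_iff (isUnit_iff_ne_zero.2 fourierConst_ne_zero) _).1 hf'
  rw [fourierT_eq (fourierT f), funext (fourierT_eq f), laplace_const_mul,
    laplace_laplace_complexify hfc hf h1, ← mul_assoc, ← mul_assoc, fourierConst_sq, one_mul]

theorem phi_neg (H : WeightFamily n) (ν : ℕ) (t : Fin n → ℝ) :
    phi H ν (fun j => -t j) = phi H ν t := by
  simp only [phi, abs_neg]

theorem eTerm_comp_neg (H : WeightFamily n) (ν m : ℕ) (F : CSp n → ℂ) (z : CSp n) :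
    eTerm (phi H ν) m (fun z => F (-z)) z = eTerm (phi H ν) m F (-z) := by
  have h : phi H ν (fun j => ((-z) j).im) = phi H ν fun j => (z j).im := by
    rw [← phi_neg]
    simp
  rw [eTerm, eTerm, norm_neg, h]

theorem eNorm_comp_neg (H : WeightFamily n) (ν m : ℕ) (F : CSp n → ℂ) :
    eNorm (phi H ν) m (fun z => F (-z)) = eNorm (phi H ν) m F := by
  simp only [eNorm, eTerm_comp_neg]
  exact (Equiv.neg (CSp n)).iSup_comp (g := fun z => eTerm (phi H ν) m F z)

theorem comp_neg_mem_Estep (H : WeightFamily n) {ν : ℕ} {F : CSp n → ℂ}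
    (hF : F ∈ Estep (phi H ν)) : (fun z => F (-z)) ∈ Estep (phi H ν) := by
  refine (Submodule.mem_iInf _).2 fun m => ?_
  obtain ⟨h1, A, hA⟩ := (Submodule.mem_iInf _).1 hF m
  refine ⟨h1.comp differentiable_id.neg, A, ?_⟩
  rintro _ ⟨z, rfl⟩
  rw [eTerm_comp_neg]
  exact hA ⟨-z, rfl⟩

/-- The inverse transform of an entire function `F`: the Fourier transform of `x ↦ F(-x)` on
`ℝⁿ`. -/
noncomputable def invTransform (F : CSp n → ℂ) : RSp n → ℂ :=
  fourierT fun x => F (-complexify x)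

theorem invTransform_mem_Gstep (H : WeightFamily n) {ν : ℕ} {F : CSp n → ℂ}
    (hF : F ∈ Estep (phi H ν)) : invTransform F ∈ Gstep (H.h (ν + 1)) :=
  fourierT_complexify_mem_Gstep H (F := fun z => F (-z)) (comp_neg_mem_Estep H hF)

theorem gNorm_invTransform_le (H : WeightFamily n) (ν m : ℕ) :
    ∃ C : ℝ, 0 < C ∧ ∀ F : CSp n → ℂ, F ∈ Estep (phi H ν) →
      gNorm (H.h (ν + 1)) m (invTransform F) ≤ C * eNorm (phi H ν) (m + (n + 1)) F := by
  obtain ⟨C, hC, h⟩ := gTerm_fourierT_complexify_le H ν m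
  refine ⟨C, hC, fun F hF => ?_⟩
  have : Nonempty (GIndex n m) := ⟨(0, 0, ⟨0, by simp⟩)⟩
  have h1 := h (fun z => F (-z)) (comp_neg_mem_Estep H hF)
  rw [eNorm_comp_neg] at h1
  exact ciSup_le h1

/-- The transform `z ↦ (2π)^{-n/2} ∫ f(ξ) e^{i⟨z, ξ⟩} dξ`, which extends `𝓕 f` to `ℂⁿ`. -/
noncomputable def transform (f : RSp n → ℂ) : CSp n → ℂ := fun z => fourierConst n * laplace f z

theorem transform_complexify (f : RSp n → ℂ) (x : RSp n) :
    transform f (complexify x) = fourierT f x :=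
  (fourierT_eq f x).symm

theorem transform_mem_Estep (H : WeightFamily n) {ν : ℕ} {f : RSp n → ℂ}
    (hf : f ∈ Gstep (H.h ν)) : transform f ∈ Estep (phi H (ν + 1)) :=
  (Submodule.mem_iInf _).2 fun m => (Em (phi H (ν + 1)) m).smul_mem (fourierConst n)
    (laplace_mem_Em H ((Submodule.mem_iInf _).1 hf m))

theorem eNorm_transform_le (H : WeightFamily n) (ν m : ℕ) :
    ∃ C : ℝ, 0 < C ∧ ∀ f : RSp n → ℂ, f ∈ Gstep (H.h ν) →
      eNorm (phi H (ν + 1)) m (transform f) ≤ C * gNorm (H.h ν) m f := by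
  obtain ⟨C, hC, h⟩ := eTerm_laplace_le H ν m
  refine ⟨‖fourierConst n‖ * C, mul_pos (norm_pos_iff.2 fourierConst_ne_zero) hC,
    fun f hf => ciSup_le fun z => ?_⟩
  have h1 := h f ((Submodule.mem_iInf _).1 hf m) z
  have h2 : eTerm (phi H (ν + 1)) m (transform f) z =
      ‖fourierConst n‖ * eTerm (phi H (ν + 1)) m (laplace f) z := by
    rw [eTerm, eTerm, transform, norm_mul]
    ring
  rw [h2, mul_assoc]
  exact mul_le_mul_of_nonneg_left h1 (norm_nonneg _)

theorem transform_invTransform (H : WeightFamily n) {ν : ℕ} {F : CSp n → ℂ}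
    (hF : F ∈ Estep (phi H ν)) : transform (invTransform F) = F := by
  have hG := (Submodule.mem_iInf _).1 (invTransform_mem_Gstep H hF) 0
  have hd := hasExpDecay_of_mem H hG
  have hF' := comp_neg_mem_Estep H hF
  have hF0 := (Submodule.mem_iInf _).1 hF 0
  have hc : Continuous fun x : RSp n => F (-complexify x) :=
    hF0.1.continuous.comp continuous_complexify.neg
  refine eq_of_eqOn_complexify (hd.differentiable_laplace.const_mul _) hF0.1 fun x => ?_
  rw [transform_complexify, invTransform, fourierT_fourierT hc ?_ hd.integrable]
  · congr 1
    ext j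
    simp
  · rw [← integrable_norm_iff hc.aestronglyMeasurable]
    simpa using integrable_pow_norm_mul_complexify hF' 0

theorem invTransform_transform (H : WeightFamily n) {ν : ℕ} {f : RSp n → ℂ}
    (hf : f ∈ Gstep (H.h ν)) : invTransform (transform f) = f := by
  have hd := hasExpDecay_of_mem H ((Submodule.mem_iInf _).1 hf 0)
  have hT := transform_mem_Estep H hf
  have hc : Continuous (fourierT f) :=
    (contDiff_fourierT hd.integrable_pow_norm_mul).continuous
  have hi : Integrable (fourierT f) := by
    rw [← integrable_norm_iff hc.aestronglyMeasurable]
    simpa [transform_complexify] using integrable_pow_norm_mul_complexify hT 0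
  funext ξ
  have h1 : fourierT (fourierT f) (-ξ) = f ξ := by
    rw [fourierT_fourierT hd.1 hd.integrable hi, neg_neg]
  rw [← h1, invTransform, fourierT_eq, fourierT_eq (fourierT f)]
  congr 1
  rw [laplace, laplace, ← integral_neg_eq_self]
  refine integral_congr_ae (Eventually.of_forall fun x => ?_)
  have e : -complexify (-x) = complexify x := by ext j; simp
  simp only [e, transform_complexify, pairing_complexify, inner_neg_left, inner_neg_right]

/-! ### Inductive limits -/

section InductiveLimit

variable {X : Type*} [AddCommGroup X] [Module ℂ X] {S : ℕ → Type*}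
  [∀ ν, AddCommGroup (S ν)] [∀ ν, Module ℂ (S ν)] (t : ∀ ν, TopologicalSpace (S ν))
  (ι : ∀ ν, S ν →ₗ[ℂ] X)

theorem isTopologicalAddGroup_inductiveLimit :
    @IsTopologicalAddGroup X (inductiveLimitTopology t ι) _ :=
  topologicalAddGroup_sInf fun _ h => h.2.1

theorem continuousSMul_inductiveLimit :
    @ContinuousSMul ℂ X _ _ (inductiveLimitTopology t ι) :=
  continuousSMul_sInf fun _ h => h.2.2.1

theorem locallyConvexSpace_inductiveLimit :
    @LocallyConvexSpace ℝ X _ _ _ _ (inductiveLimitTopology t ι) :=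
  LocallyConvexSpace.sInf fun _ h => h.2.2.2

theorem continuous_inductiveLimit_incl (ν : ℕ) :
    @Continuous _ _ (t ν) (inductiveLimitTopology t ι) (ι ν) :=
  continuous_sInf_rng.2 fun _ h => h.1 ν

/-- The universal property of the locally convex inductive limit. -/
theorem continuous_of_inductiveLimit {Y : Type*} [AddCommGroup Y] [Module ℂ Y]
    [TopologicalSpace Y] [IsTopologicalAddGroup Y] [ContinuousSMul ℂ Y] [LocallyConvexSpace ℝ Y]
    (L : X →ₗ[ℂ] Y) (h : ∀ ν, @Continuous _ _ (t ν) _ fun x => L (ι ν x)) :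
    @Continuous _ _ (inductiveLimitTopology t ι) _ L := by
  refine continuous_iff_le_induced.2 (sInf_le ⟨fun ν => ?_, ?_, ?_, ?_⟩)
  · exact continuous_induced_rng.2 (h ν)
  · exact topologicalAddGroup_induced L
  · exact continuousSMul_induced L
  · exact LocallyConvexSpace.induced (L.restrictScalars ℝ)

end InductiveLimit

instance (H : WeightFamily n) : IsTopologicalAddGroup (GSpace H) :=
  isTopologicalAddGroup_inductiveLimit (fun ν => gTopology (H.h ν)) (GSpace.incl H)

instance (H : WeightFamily n) : ContinuousSMul ℂ (GSpace H) :=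
  continuousSMul_inductiveLimit (fun ν => gTopology (H.h ν)) (GSpace.incl H)

instance (H : WeightFamily n) : LocallyConvexSpace ℝ (GSpace H) :=
  locallyConvexSpace_inductiveLimit (fun ν => gTopology (H.h ν)) (GSpace.incl H)

instance (H : WeightFamily n) : IsTopologicalAddGroup (ESpace H) :=
  isTopologicalAddGroup_inductiveLimit (fun ν => eTopology (phi H ν)) (ESpace.incl H)

instance (H : WeightFamily n) : ContinuousSMul ℂ (ESpace H) :=
  continuousSMul_inductiveLimit (fun ν => eTopology (phi H ν)) (ESpace.incl H)

instance (H : WeightFamily n) : LocallyConvexSpace ℝ (ESpace H) :=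
  locallyConvexSpace_inductiveLimit (fun ν => eTopology (phi H ν)) (ESpace.incl H)

/-- A linear map between spaces topologised by countable families of seminorms is continuous if
every seminorm of the image is bounded by a multiple of a seminorm of the argument. -/
theorem continuous_of_seminorm_le {X Y : Type*} [AddCommGroup X] [Module ℂ X] [AddCommGroup Y]
    [Module ℂ Y] (p : SeminormFamily ℂ X ℕ) (q : SeminormFamily ℂ Y ℕ) (L : X →ₗ[ℂ] Y)
    (h : ∀ m, ∃ k, ∃ C : ℝ, 0 < C ∧ ∀ x, q m (L x) ≤ C * p k x) :
    @Continuous _ _ p.moduleFilterBasis.topology q.moduleFilterBasis.topology L := by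
  let _ := p.moduleFilterBasis.topology
  let _ := q.moduleFilterBasis.topology
  have hp : WithSeminorms p := ⟨rfl⟩
  have hq : WithSeminorms q := ⟨rfl⟩
  refine WithSeminorms.continuous_of_isBounded hp hq L fun m => ?_
  obtain ⟨k, C, hC, hle⟩ := h m
  refine ⟨{k}, ⟨C, hC.le⟩, fun x => ?_⟩
  rw [Finset.sup_singleton]
  exact hle x

/-! ### The isomorphism -/

theorem transform_lin {f g : RSp n → ℂ} (hf : HasExpDecay f) (hg : HasExpDecay g) (c : ℂ) :
    transform (c • f + g) = c • transform f + transform g := by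
  funext z
  have h : laplace (c • f + g) z = c * laplace f z + laplace g z := by
    rw [laplace, laplace, laplace, ← integral_const_mul,
      ← integral_add ((hf.integrable_laplace z).const_mul c) (hg.integrable_laplace z)]
    refine integral_congr_ae (Eventually.of_forall fun ξ => ?_)
    simp only [Pi.add_apply, Pi.smul_apply, smul_eq_mul]
    ring
  simp only [transform, h, Pi.add_apply, Pi.smul_apply, smul_eq_mul]
  ring

theorem hasExpDecay_of_mem_Gstep (H : WeightFamily n) {ν : ℕ} {f : RSp n → ℂ}
    (hf : f ∈ Gstep (H.h ν)) : HasExpDecay f :=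
  hasExpDecay_of_mem H ((Submodule.mem_iInf _).1 hf 0)

theorem GSpace.hasExpDecay {H : WeightFamily n} (f : GSpace H) : HasExpDecay f.fn :=
  f.2.elim fun _ h => hasExpDecay_of_mem_Gstep H h

/-- The transform as a linear map from `G(H)` to `E(Φ)`. -/
noncomputable def transformLinear (H : WeightFamily n) : GSpace H →ₗ[ℂ] ESpace H where
  toFun f := ⟨transform f.fn, f.2.elim fun ν h => ⟨ν + 1, transform_mem_Estep H h⟩⟩
  map_add' f g := Subtype.ext (by
    have h := transform_lin f.hasExpDecay g.hasExpDecay 1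
    rw [one_smul, one_smul] at h
    exact h)
  map_smul' c f := Subtype.ext (by
    have h := transform_lin f.hasExpDecay f.hasExpDecay (c - 1)
    have e : ∀ F : RSp n → ℂ, (c - 1) • F + F = c • F := fun F => by
      rw [sub_smul, one_smul, sub_add_cancel]
    have e' : ∀ F : CSp n → ℂ, (c - 1) • F + F = c • F := fun F => by
      rw [sub_smul, one_smul, sub_add_cancel]
    rw [e, e'] at h
    exact h)

/-- The transform as a linear equivalence from `G(H)` to `E(Φ)`. -/
noncomputable def transformEquiv (H : WeightFamily n) : GSpace H ≃ₗ[ℂ] ESpace H :=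
  { transformLinear H with
    invFun := fun F => ⟨invTransform F.fn, F.2.elim fun ν h => ⟨ν + 1, invTransform_mem_Gstep H h⟩⟩
    left_inv := fun f => Subtype.ext (f.2.elim fun _ h => invTransform_transform H h)
    right_inv := fun F => Subtype.ext (F.2.elim fun _ h => transform_invTransform H h) }

theorem continuous_transformEquiv (H : WeightFamily n) : Continuous (transformEquiv H) := by
  refine continuous_of_inductiveLimit (fun ν => gTopology (H.h ν)) (GSpace.incl H)
    (transformEquiv H).toLinearMap fun ν => ?_
  let T : Gstep (H.h ν) →ₗ[ℂ] Estep (phi H (ν + 1)) :=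
    { toFun := fun f => ⟨transform f.1, transform_mem_Estep H f.2⟩
      map_add' := fun f g => Subtype.ext (congrArg ESpace.fn
        ((transformEquiv H).map_add (GSpace.incl H ν f) (GSpace.incl H ν g)))
      map_smul' := fun c f => Subtype.ext (congrArg ESpace.fn
        ((transformEquiv H).map_smul c (GSpace.incl H ν f))) }
  have hT := continuous_of_seminorm_le (gFamily (H.h ν)) (eFamily (phi H (ν + 1))) T fun m => by
    obtain ⟨C, hC, h⟩ := eNorm_transform_le H ν m
    exact ⟨m, C, hC, fun f => h f.1 f.2⟩
  exact @Continuous.comp _ _ _ (gTopology (H.h ν)) (eTopology (phi H (ν + 1))) _ _ _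
    (continuous_inductiveLimit_incl (fun ν => eTopology (phi H ν)) (ESpace.incl H) (ν + 1)) hT

theorem continuous_transformEquiv_symm (H : WeightFamily n) :
    Continuous (transformEquiv H).symm := by
  refine continuous_of_inductiveLimit (fun ν => eTopology (phi H ν)) (ESpace.incl H)
    (transformEquiv H).symm.toLinearMap fun ν => ?_
  let T : Estep (phi H ν) →ₗ[ℂ] Gstep (H.h (ν + 1)) :=
    { toFun := fun F => ⟨invTransform F.1, invTransform_mem_Gstep H F.2⟩
      map_add' := fun F G => Subtype.ext (congrArg GSpace.fn
        ((transformEquiv H).symm.map_add (ESpace.incl H ν F) (ESpace.incl H ν G)))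
      map_smul' := fun c F => Subtype.ext (congrArg GSpace.fn
        ((transformEquiv H).symm.map_smul c (ESpace.incl H ν F))) }
  have hT := continuous_of_seminorm_le (eFamily (phi H ν)) (gFamily (H.h (ν + 1))) T fun m => by
    obtain ⟨C, hC, h⟩ := gNorm_invTransform_le H ν m
    exact ⟨m + (n + 1), C, hC, fun F => h F.1 F.2⟩
  exact @Continuous.comp _ _ _ (eTopology (phi H ν)) (gTopology (H.h (ν + 1))) _ _ _
    (continuous_inductiveLimit_incl (fun ν => gTopology (H.h ν)) (GSpace.incl H) (ν + 1)) hT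

end PaleyWiener

theorem theorem2 (n : ℕ) (H : PaleyWiener.WeightFamily n) :
    ∃ Ψ : PaleyWiener.GSpace H ≃L[ℂ] PaleyWiener.ESpace H,
      ∀ f : PaleyWiener.GSpace H,
        Integrable f.fn ∧
        ∃ hf : PaleyWiener.fourierT f.fn ∈ PaleyWiener.calE H,
          (∀ z, Summable (PaleyWiener.taylorTerm (PaleyWiener.fourierT f.fn) z)) ∧
          (∀ x : PaleyWiener.RSp n,
            PaleyWiener.extensionMap H ⟨PaleyWiener.fourierT f.fn, hf⟩
              (WithLp.toLp 2 fun j => (x j : ℂ)) = PaleyWiener.fourierT f.fn x) ∧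
          (Ψ f).fn = PaleyWiener.extensionMap H ⟨PaleyWiener.fourierT f.fn, hf⟩ := by
  refine ⟨⟨PaleyWiener.transformEquiv H, PaleyWiener.continuous_transformEquiv H,
    PaleyWiener.continuous_transformEquiv_symm H⟩, fun f => ?_⟩
  obtain ⟨ν, hν⟩ : ∃ ν, f.fn ∈ PaleyWiener.Gstep (H.h ν) := f.2
  have hsum := PaleyWiener.hasSum_taylorTerm_fourierT H hν
  exact ⟨f.hasExpDecay.integrable, PaleyWiener.fourierT_mem_calE H hν, fun z => (hsum z).summable,
    fun x => (hsum (PaleyWiener.complexify x)).tsum_eq.trans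
      (PaleyWiener.transform_complexify f.fn x),
    funext fun z => (hsum z).tsum_eq.symm⟩
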